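/- Let $N,r,s\ge 1$ and let $A=(A_{k,l})_{k,l\ge 0}$ be an infinite matrix with entries $A_{k,l}\in\mathbb C^{N\times N}$ such that $A_{k,l}=O$ for $l<k-s$ and for $l>k+r$, the matrices $A_{k,k+r}$ and $A_{k+s,k}$ are invertible for all $k\ge 0$, and $\sup_{i,j\ge 0}\|A_{i,j}\|<\infty$. Then $A$ generates a bounded operator, also denoted $A$, on the Hilbert space $l^2_N$ of square summable sequences $(u_0,u_1,\dots)$, $u_j\in\mathbb C^N$. Let $E$ be the unit matrix of order $N$. Extend $A$ to negative indices by $A_{k,k-s}=-E$ for $0\le k<s$, $A_{k-r,k}=-E$ for $0\le k<r$, all other new elements being $O$. For $\lambda\in\mathbb C$ consider, for $k\ge 0$, the equations $$A_{k,k-s}Y_{k-s}+\dots+A_{k,k+r}Y_{k+r}=\lambda Y_k,\qquad (1)$$ $$Y^+_{k-r}A_{k-r,k}+\dots+Y^+_{k+s}A_{k+s,k}=\lambda Y^+_k.\qquad (2)$$ Let $Q_k(\lambda)=(Q_k^1,\dots,Q_k^r)$ and $P_k(\lambda)=(P_k^1,\dots,P_k^s)$, $k\ge -s$, be the block rows whose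 components solve (1) and which satisfy the initial conditions that the stacked matrices of rows $-s,\dots,-1$ and $0,\dots,r-1$ are $Q_{-s:-1}=0$, $Q_{0:r-1}=I_r$, $P_{-s:-1}=I_s$, $P_{0:r-1}=0$. Let $Q^+_k(\lambda)$ (with $s$ components) and $P^+_k(\lambda)$ (with $r$ components), $k\ge -r$, be the block columns whose components solve (2) and which satisfy $Q^+_{-r:-1}=0$, $Q^+_{0:s-1}=I_s$, $P^+_{-r:-1}=I_r$, $P^+_{0:s-1}=0$. Here $I_i$ is the identity block matrix with $i\times i$ blocks of order $N$. All these components are polynomials in $\lambda$ with matrix coefficients. For an $r\times s$ block matrix $\mathfrak M=(\mathfrak M_{i,j})$, $\mathfrak M_{i,j}\in\mathbb C^{N\times N}$, put $R_k=Q_k\mathfrak M-P_k$, $R_n^+=\mathfrak M Q_n^+-P_n^+$ and, for $k,n\ge 0$, $$R_{k,n}=\begin{cases}Q_k(\lambda)R_n^+(\lambda), & 0\le k<n+r,\\ R_k(\lambda)Q_n^+(\lambda), & 0\le n<k+s,\end{cases}$$ where the two expressions agree whenever both cases apply. Then $\lambda$ belongs to the resolvent set of $A$ if and only if there exist constants $C>0$,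 $0<q<1$ and an $r\times s$ block matrix $\mathfrak M$ such that $$\|R_{k,n}\|\le C\,q^{|n-k|}\qquad\text{for all } k,n\ge 0.\qquad (3)$$ In this case the matrix $\mathfrak M$ admitting such constants is unique, $\mathfrak M=(R_{i,j})_{i=0,\dots,r-1}^{j=0,\dots,s-1}$, and it coincides with the Weyl matrix of $A$ at $\lambda$, that is, with the upper left $r\times s$ block of the matrix (with elements of order $N$) of the resolvent $(\lambda I-A)^{-1}$. -/

import Mathlib

open scoped Matrix Matrix.Norms.L2Operator

noncomputable section

namespace BandResolvent

/-- The ring of complex matrices of order `N`, in which the entries of all (infinite or block)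
matrices below live. It carries the operator norm induced by the Euclidean norm of `ℂ^N`. -/
abbrev Blk (N : ℕ) : Type := Matrix (Fin N) (Fin N) ℂ

/-- The Hilbert space `l^2_N` of square summable sequences of vectors of `ℂ^N`. -/
abbrev L2Seq (N : ℕ) : Type := lp (fun _ : ℕ => EuclideanSpace ℂ (Fin N)) 2

/-- `A_{k,l} = O` for `l < k - s` and for `l > k + r`, and `A_{k,k+r}`, `A_{k+s,k}` are
invertible for all `k`. -/
structure IsBand {N : ℕ} (r s : ℕ) (A : ℕ → ℕ → Blk N) : Prop where
  zero_lower : ∀ k l, l + s < k → A k l = 0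
  zero_upper : ∀ k l, k + r < l → A k l = 0
  isUnit_upper : ∀ k, IsUnit (A k (k + r))
  isUnit_lower : ∀ k, IsUnit (A (k + s) k)

/-- `sup_{i,j} ‖A_{i,j}‖ < ∞`. -/
def IsBdd {N : ℕ} (A : ℕ → ℕ → Blk N) : Prop := ∃ C : ℝ, ∀ i j, ‖A i j‖ ≤ C

/-! ### The bounded operator generated by a bounded band matrix -/

/-- `(A u)_k = ∑_l A_{k,l} u_l`; the terms with `l > k + r` vanish. -/
def bandApply {N : ℕ} (r : ℕ) (A : ℕ → ℕ → Blk N) (u : ℕ → EuclideanSpace ℂ (Fin N)) (k : ℕ) :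
    EuclideanSpace ℂ (Fin N) :=
  ∑ l ∈ Finset.range (k + r + 1), Matrix.toEuclideanCLM (𝕜 := ℂ) (A k l) (u l)

/-- Shifted squared norms of a sequence, extended by zero. -/
def shiftSq {N : ℕ} (s : ℕ) (u : ℕ → EuclideanSpace ℂ (Fin N)) (m : ℕ) : ℝ :=
  if s ≤ m then ‖u (m - s)‖ ^ 2 else 0

theorem bandApply_eq {N r s : ℕ} {A : ℕ → ℕ → Blk N} (hA : IsBand r s A)
    (u : ℕ → EuclideanSpace ℂ (Fin N)) (k : ℕ) :
    bandApply r A u k = ∑ j ∈ Finset.range (s + r + 1),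
      if s ≤ k + j then Matrix.toEuclideanCLM (𝕜 := ℂ) (A k (k + j - s)) (u (k + j - s))
      else 0 := by
  set F : ℕ → EuclideanSpace ℂ (Fin N) := fun m =>
    if s ≤ m then Matrix.toEuclideanCLM (𝕜 := ℂ) (A k (m - s)) (u (m - s)) else 0 with hF
  have h1 : ∑ m ∈ Finset.range (s + (k + r + 1)), F m = bandApply r A u k := by
    rw [Finset.sum_range_add, Finset.sum_eq_zero, zero_add]
    · exact Finset.sum_congr rfl fun l _ => by simp [hF]
    · intro m hm
      have := Finset.mem_range.1 hm
      simp [hF, this]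
  have h2 : ∑ m ∈ Finset.range (k + (s + r + 1)), F m =
      ∑ j ∈ Finset.range (s + r + 1), F (k + j) := by
    rw [Finset.sum_range_add, Finset.sum_eq_zero, zero_add]
    intro m hm
    have := Finset.mem_range.1 hm
    by_cases h : s ≤ m
    · simp [hF, h, hA.zero_lower k (m - s) (by omega)]
    · simp [hF, h]
  rw [← h1, show s + (k + r + 1) = k + (s + r + 1) by ring, h2]

theorem bandApply_norm_sq_le {N r s : ℕ} {A : ℕ → ℕ → Blk N} (hA : IsBand r s A) {C : ℝ}
    (hC : ∀ i j, ‖A i j‖ ≤ C) (u : ℕ → EuclideanSpace ℂ (Fin N)) (k : ℕ) :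
    ‖bandApply r A u k‖ ^ 2 ≤
      ∑ j ∈ Finset.range (s + r + 1), (s + r + 1) * C ^ 2 * shiftSq s u (k + j) := by
  rw [bandApply_eq hA]
  refine (pow_le_pow_left₀ (norm_nonneg _) (norm_sum_le _ _) 2).trans ?_
  refine sq_sum_le_card_mul_sum_sq.trans ?_
  rw [Finset.card_range, Finset.mul_sum]
  refine Finset.sum_le_sum fun j _ => ?_
  push_cast
  rw [mul_assoc]
  refine mul_le_mul_of_nonneg_left ?_ (by positivity)
  unfold shiftSq
  split_ifs with h
  · rw [← mul_pow]
    refine pow_le_pow_left₀ (norm_nonneg _) ?_ 2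
    refine (ContinuousLinearMap.le_opNorm _ _).trans ?_
    exact mul_le_mul_of_nonneg_right (hC _ _) (norm_nonneg _)
  · simp

theorem shiftSq_hasSum {N : ℕ} (s : ℕ) (u : L2Seq N) : HasSum (shiftSq s u) (‖u‖ ^ 2) := by
  have h : HasSum (fun i => ‖u i‖ ^ 2) (‖u‖ ^ 2) := by
    simpa using lp.hasSum_norm (p := 2) (by simp) u
  rw [← hasSum_nat_add_iff' s, Finset.sum_eq_zero, sub_zero]
  · simpa [shiftSq] using h
  · intro m hm
    have := Finset.mem_range.1 hm
    simp [shiftSq, this]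

theorem shiftSq_nonneg {N : ℕ} (s : ℕ) (u : ℕ → EuclideanSpace ℂ (Fin N)) (m : ℕ) :
    0 ≤ shiftSq s u m := by
  unfold shiftSq; split_ifs <;> positivity

theorem summable_bound {N : ℕ} (r s : ℕ) (C : ℝ) (u : L2Seq N) :
    Summable fun k => ∑ j ∈ Finset.range (s + r + 1),
      ((s : ℝ) + r + 1) * C ^ 2 * shiftSq s u (k + j) :=
  summable_sum fun j _ =>
    ((summable_nat_add_iff j).2 (shiftSq_hasSum s u).summable).mul_left _

theorem tsum_bound {N : ℕ} (r s : ℕ) (C : ℝ) (u : L2Seq N) :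
    ∑' k, ∑ j ∈ Finset.range (s + r + 1), ((s : ℝ) + r + 1) * C ^ 2 * shiftSq s u (k + j) ≤
      (((s : ℝ) + r + 1) * |C| * ‖u‖) ^ 2 := by
  have hs (j : ℕ) := (summable_nat_add_iff j).2 (shiftSq_hasSum s u).summable
  rw [Summable.tsum_finsetSum fun j _ => (hs j).mul_left _]
  calc _ ≤ ∑ j ∈ Finset.range (s + r + 1), ((s : ℝ) + r + 1) * C ^ 2 * ‖u‖ ^ 2 := by
        refine Finset.sum_le_sum fun j _ => ?_
        rw [tsum_mul_left]
        refine mul_le_mul_of_nonneg_left ?_ (by positivity)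
        rw [← (shiftSq_hasSum s u).tsum_eq,
          ← (shiftSq_hasSum s u).summable.sum_add_tsum_nat_add j]
        exact le_add_of_nonneg_left (Finset.sum_nonneg fun _ _ => shiftSq_nonneg _ _ _)
    _ = _ := by
        rw [Finset.sum_const, Finset.card_range, nsmul_eq_mul, mul_pow, mul_pow, sq_abs]
        push_cast
        ring

theorem bandApply_memℓp {N r s : ℕ} {A : ℕ → ℕ → Blk N} (hA : IsBand r s A) (hb : IsBdd A)
    (u : L2Seq N) : Memℓp (bandApply r A u) 2 := by
  obtain ⟨C, hC⟩ := hb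
  refine memℓp_gen ?_
  have : Summable fun k => ‖bandApply r A u k‖ ^ 2 :=
    (summable_bound r s C u).of_nonneg_of_le (fun _ => by positivity)
      (bandApply_norm_sq_le hA hC u)
  simpa using this

/-- The linear map `u ↦ A u` on `l^2_N`. -/
def bandLinear {N r s : ℕ} (A : ℕ → ℕ → Blk N) (hA : IsBand r s A) (hb : IsBdd A) :
    L2Seq N →ₗ[ℂ] L2Seq N where
  toFun u := ⟨bandApply r A u, bandApply_memℓp hA hb u⟩
  map_add' u v := by
    refine lp.ext (funext fun k => ?_)
    change bandApply r A (u + v : L2Seq N) k = bandApply r A u k + bandApply r A v k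
    simp [bandApply, Finset.sum_add_distrib]
  map_smul' c u := by
    refine lp.ext (funext fun k => ?_)
    change bandApply r A (c • u : L2Seq N) k = c • bandApply r A u k
    simp [bandApply, Finset.smul_sum]

theorem bandLinear_bound {N r s : ℕ} (A : ℕ → ℕ → Blk N) (hA : IsBand r s A) (hb : IsBdd A) :
    ∃ D : ℝ, ∀ u, ‖bandLinear A hA hb u‖ ≤ D * ‖u‖ := by
  obtain ⟨C, hC⟩ := id hb
  refine ⟨((s : ℝ) + r + 1) * |C|, fun u => ?_⟩
  refine (pow_le_pow_iff_left₀ (norm_nonneg _) (by positivity) two_ne_zero).1 ?_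
  refine le_trans ?_ (tsum_bound r s C u)
  have h : HasSum (fun i => ‖bandApply r A u i‖ ^ 2) (‖bandLinear A hA hb u‖ ^ 2) := by
    have h2 := lp.hasSum_norm (p := 2) (by simp) (bandLinear A hA hb u)
    simp only [ENNReal.toReal_ofNat, Real.rpow_ofNat] at h2
    exact h2
  rw [← h.tsum_eq]
  exact h.summable.tsum_le_tsum (bandApply_norm_sq_le hA hC u) (summable_bound r s C u)

/-- The bounded operator on `l^2_N` generated by a bounded band matrix `A`:
`(A u)_k = ∑_l A_{k,l} u_l`. -/
def bandOp {N r s : ℕ} (A : ℕ → ℕ → Blk N) (hA : IsBand r s A) (hb : IsBdd A) :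
    L2Seq N →L[ℂ] L2Seq N :=
  ⟨bandLinear A hA hb,
    AddMonoidHomClass.continuous_of_bound _ _ (bandLinear_bound A hA hb).choose_spec⟩

/-- The `(i, j)` matrix element, a matrix of order `N`, of an operator `B` on `l^2_N`. -/
def blockEntry {N : ℕ} (B : L2Seq N →L[ℂ] L2Seq N) (i j : ℕ) : Blk N :=
  Matrix.of fun a b => B (lp.single 2 j (EuclideanSpace.single b (1 : ℂ))) i a

/-- The Weyl matrix: the upper left `r × s` block of the matrix of the resolvent
`(λ I - A)⁻¹`. -/
def weylMatrix {N : ℕ} (r s : ℕ) (T : L2Seq N →L[ℂ] L2Seq N) (lam : ℂ) :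
    Matrix (Fin r) (Fin s) (Blk N) :=
  Matrix.of fun i j => blockEntry (resolvent T lam) i j

/-! ### The difference equations and their fundamental solutions -/

/-- The matrix `A` extended to negative indices: `A_{k,k-s} = -E` for `0 ≤ k < s`,
`A_{k-r,k} = -E` for `0 ≤ k < r`, and all other new elements are `O`. -/
def extMat {N : ℕ} (r s : ℕ) (A : ℕ → ℕ → Blk N) (k l : ℤ) : Blk N :=
  if 0 ≤ k ∧ 0 ≤ l then A k.toNat l.toNat
  else if (0 ≤ k ∧ l = k - s) ∨ (0 ≤ l ∧ k = l - r) then -1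
  else 0

/-- `Y` solves `A_{k,k-s} Y_{k-s} + ⋯ + A_{k,k+r} Y_{k+r} = λ Y_k`, `k ≥ 0`. Only the values
`Y_k` with `k ≥ -s` matter. -/
def IsSol {N : ℕ} (r s : ℕ) (A : ℕ → ℕ → Blk N) (lam : ℂ) (Y : ℤ → Blk N) : Prop :=
  ∀ k : ℤ, 0 ≤ k → ∑ j ∈ Finset.range (s + r + 1),
    extMat r s A k (k - s + j) * Y (k - s + j) = lam • Y k

/-- `Y⁺` solves `Y⁺_{k-r} A_{k-r,k} + ⋯ + Y⁺_{k+s} A_{k+s,k} = λ Y⁺_k`, `k ≥ 0`. Only the values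
`Y⁺_k` with `k ≥ -r` matter. -/
def IsDualSol {N : ℕ} (r s : ℕ) (A : ℕ → ℕ → Blk N) (lam : ℂ) (Y : ℤ → Blk N) : Prop :=
  ∀ k : ℤ, 0 ≤ k → ∑ j ∈ Finset.range (r + s + 1),
    Y (k - r + j) * extMat r s A (k - r + j) k = lam • Y k

/-- The solution of the first equation with initial values `Y_k = c k`, `-s ≤ k < r`, obtained
by solving the equation for `Y_{k+r}`. For `r ≥ 1` the term `λ Y_k` is the one with `j = s`. -/
def sol {N : ℕ} (r s : ℕ) (A : ℕ → ℕ → Blk N) (lam : ℂ) (c : ℤ → Blk N) (k : ℤ) : Blk N :=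
  if k < r then c k
  else (extMat r s A (k - r) k)⁻¹ * ∑ j : Fin (s + r),
    ((if (j : ℕ) = s then lam • 1 else 0) - extMat r s A (k - r) (k - r - s + (j : ℕ))) *
      sol r s A lam c (k - r - s + (j : ℕ))
termination_by (k + s).toNat
decreasing_by omega

/-- The solution of the dual equation with initial values `Y⁺_k = c k`, `-r ≤ k < s`, obtained
by solving the equation for `Y⁺_{k+s}`. For `s ≥ 1` the term `λ Y⁺_k` is the one with
`j = r`. -/
def dualSol {N : ℕ} (r s : ℕ) (A : ℕ → ℕ → Blk N) (lam : ℂ) (c : ℤ → Blk N) (k : ℤ) : Blk N :=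
  if k < s then c k
  else (∑ j : Fin (r + s), dualSol r s A lam c (k - s - r + (j : ℕ)) *
      ((if (j : ℕ) = r then lam • 1 else 0) - extMat r s A (k - s - r + (j : ℕ)) (k - s))) *
    (extMat r s A k (k - s))⁻¹
termination_by (k + r).toNat
decreasing_by omega

/-- `sol` solves the first equation. -/
theorem isSol_sol {N r s : ℕ} {A : ℕ → ℕ → Blk N} (hr : 1 ≤ r) (hA : IsBand r s A) (lam : ℂ)
    (c : ℤ → Blk N) : IsSol r s A lam (sol r s A lam c) := by
  intro k hk
  have hu : IsUnit (extMat r s A k (k + r)).det := by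
    rw [← Matrix.isUnit_iff_isUnit_det]
    lift k to ℕ using hk
    rw [extMat, if_pos (by omega)]
    exact hA.isUnit_upper k
  have e : sol r s A lam c (k + r) = (extMat r s A k (k + r))⁻¹ *
      ∑ j ∈ Finset.range (s + r), ((if j = s then lam • 1 else 0) -
        extMat r s A k (k - s + j)) * sol r s A lam c (k - s + j) := by
    rw [sol, if_neg (by omega), ← Fin.sum_univ_eq_sum_range]
    simp only [add_sub_cancel_right]
  rw [Finset.sum_range_succ, show k - s + ((s + r : ℕ) : ℤ) = k + r by push_cast; ring, e,
    Matrix.mul_nonsing_inv_cancel_left _ _ hu, ← Finset.sum_add_distrib,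
    Finset.sum_eq_single_of_mem s (by simp; omega)]
  · simp [sub_mul]
  · intro j _ hj
    simp [hj]

/-- `dualSol` solves the dual equation. -/
theorem isDualSol_dualSol {N r s : ℕ} {A : ℕ → ℕ → Blk N} (hs : 1 ≤ s) (hA : IsBand r s A)
    (lam : ℂ) (c : ℤ → Blk N) : IsDualSol r s A lam (dualSol r s A lam c) := by
  intro k hk
  have hu : IsUnit (extMat r s A (k + s) k).det := by
    rw [← Matrix.isUnit_iff_isUnit_det]
    lift k to ℕ using hk
    rw [extMat, if_pos (by omega)]
    exact hA.isUnit_lower k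
  have e : dualSol r s A lam c (k + s) = (∑ j ∈ Finset.range (r + s),
      dualSol r s A lam c (k - r + j) * ((if j = r then lam • 1 else 0) -
        extMat r s A (k - r + j) k)) * (extMat r s A (k + s) k)⁻¹ := by
    rw [dualSol, if_neg (by omega), ← Fin.sum_univ_eq_sum_range]
    simp only [add_sub_cancel_right]
  rw [Finset.sum_range_succ, show k - r + ((r + s : ℕ) : ℤ) = k + s by push_cast; ring, e,
    Matrix.nonsing_inv_mul_cancel_right _ _ hu, ← Finset.sum_add_distrib,
    Finset.sum_eq_single_of_mem r (by simp; omega)]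
  · simp [mul_sub]
  · intro j _ hj
    simp [hj]

/-- `Q_k(λ) = (Q_k^1, …, Q_k^r)`: `Q_{-s:-1} = 0`, `Q_{0:r-1} = I_r`. -/
def Q {N : ℕ} (r s : ℕ) (A : ℕ → ℕ → Blk N) (lam : ℂ) (k : ℤ) : Fin r → Blk N :=
  fun i => sol r s A lam (fun m => if m = (i : ℕ) then 1 else 0) k

/-- `P_k(λ) = (P_k^1, …, P_k^s)`: `P_{-s:-1} = I_s`, `P_{0:r-1} = 0`. -/
def P {N : ℕ} (r s : ℕ) (A : ℕ → ℕ → Blk N) (lam : ℂ) (k : ℤ) : Fin s → Blk N :=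
  fun i => sol r s A lam (fun m => if m = (i : ℕ) - (s : ℤ) then 1 else 0) k

/-- The column `Q⁺_k(λ)` with components `Q_k^{1,+}, …, Q_k^{s,+}`: `Q⁺_{-r:-1} = 0`,
`Q⁺_{0:s-1} = I_s`. -/
def Qplus {N : ℕ} (r s : ℕ) (A : ℕ → ℕ → Blk N) (lam : ℂ) (k : ℤ) : Fin s → Blk N :=
  fun i => dualSol r s A lam (fun m => if m = (i : ℕ) then 1 else 0) k

/-- The column `P⁺_k(λ)` with components `P_k^{1,+}, …, P_k^{r,+}`: `P⁺_{-r:-1} = I_r`,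
`P⁺_{0:s-1} = 0`. -/
def Pplus {N : ℕ} (r s : ℕ) (A : ℕ → ℕ → Blk N) (lam : ℂ) (k : ℤ) : Fin r → Blk N :=
  fun i => dualSol r s A lam (fun m => if m = (i : ℕ) - (r : ℤ) then 1 else 0) k

/-! ### The kernel `R_{k,n}` -/

/-- The row `R_k(λ) = Q_k(λ) 𝔐 - P_k(λ)`. -/
def Rrow {N r s : ℕ} (A : ℕ → ℕ → Blk N) (lam : ℂ) (M : Matrix (Fin r) (Fin s) (Blk N))
    (k : ℤ) : Fin s → Blk N :=
  Q r s A lam k ᵥ* M - P r s A lam k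

/-- The column `R⁺_n(λ) = 𝔐 Q⁺_n(λ) - P⁺_n(λ)`. -/
def Rcol {N r s : ℕ} (A : ℕ → ℕ → Blk N) (lam : ℂ) (M : Matrix (Fin r) (Fin s) (Blk N))
    (n : ℤ) : Fin r → Blk N :=
  M *ᵥ Qplus r s A lam n - Pplus r s A lam n

/-- `R_{k,n} = Q_k R⁺_n` for `k < n + r` and `R_{k,n} = R_k Q⁺_n` for `n < k + s`. On the overlap
`n - s < k < n + r` the two products coincide; the first one is taken there. -/
def kernelR {N r s : ℕ} (A : ℕ → ℕ → Blk N) (lam : ℂ) (M : Matrix (Fin r) (Fin s) (Blk N))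
    (k n : ℕ) : Blk N :=
  if k < n + r then Q r s A lam k ⬝ᵥ Rcol A lam M n
  else Rrow A lam M k ⬝ᵥ Qplus r s A lam n

/-- There are positive constants `C` and `q < 1` with `‖R_{k,n}‖ ≤ C q^{|n-k|}` for all
`k, n ≥ 0`. -/
def KernelDecays {N r s : ℕ} (A : ℕ → ℕ → Blk N) (lam : ℂ)
    (M : Matrix (Fin r) (Fin s) (Blk N)) : Prop :=
  ∃ C q : ℝ, 0 < C ∧ 0 < q ∧ q < 1 ∧
    ∀ k n : ℕ, ‖kernelR A lam M k n‖ ≤ C * q ^ ((n : ℤ) - (k : ℤ)).natAbs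

end BandResolvent

end

/-! For every `M` the kernel `kernelR A lam M` is a formal two-sided inverse of `λ - A`, with upper
left block `M`; conversely a formal two-sided inverse is determined by that block (`eq_kernelR`).
The theorem asks which of these formal inverses is a bounded operator.

The algebra rests on two triangular inverses of `-B`, where `B = A - λ` is extended to negative
indices: `green`, supported on `k ≥ n + r`, and `greenOp`, supported on `n ≥ k + s`. Their
difference solves both homogeneous equations and has the same initial block as `Q P⁺ - P Q⁺`, hence
equals it. So `R_k Q⁺_n - Q_k R⁺_n = green - greenOp` for every `M`
(`Rrow_dotProduct_sub_dotProduct_Rcol`). By the supports, the two formulas for the kernel agree on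
the overlap, and the kernel equals both `Q_k R⁺_n + green` and `R_k Q⁺_n + greenOp` for all `k, n ≥
0`. The first form gives the row identity for `λ - A`, the second the column identity.

If the kernel decays exponentially, Schur's test (`exists_operator_of_decay`) makes it the matrix of
a bounded operator, which is then the resolvent; reading off the corner shows that `M` is the Weyl
matrix, whence uniqueness. Conversely, if `λ` lies in the resolvent set, a Combes–Thomas argument
(`exists_decay_of_inverse`) gives exponential decay of the resolvent entries, and these form the
kernel built from the Weyl matrix. -/

noncomputable section

namespace BandResolvent

open MulOpposite

/-! ### Band recurrences over a ring and their one-sided Green functions. -/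

section Green

variable {R : Type*} [Ring R]

/-- A two-sided infinite matrix which is banded on nonnegative indices, with invertible outer
diagonals, and which is continued by `-1` along the outer diagonals. -/
structure IsExtBand (r s : ℕ) (B : ℤ → ℤ → R) : Prop where
  zero_upper : ∀ j l : ℤ, 0 ≤ j → 0 ≤ l → j + r < l → B j l = 0
  zero_lower : ∀ j l : ℤ, 0 ≤ j → 0 ≤ l → l + s < j → B j l = 0
  neg_row : ∀ j l, j < 0 → 0 ≤ l → B j l = if l = j + r then -1 else 0
  neg_col : ∀ j l, 0 ≤ j → l < 0 → B j l = if j = l + s then -1 else 0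
  isUnit_upper : ∀ j, 0 ≤ j → IsUnit (B j (j + r))
  isUnit_lower : ∀ l, 0 ≤ l → IsUnit (B (l + s) l)

/-- Transposition over the opposite ring exchanges `r` and `s`; the statements on columns are
deduced from those on rows through it. -/
theorem IsExtBand.opposite {r s : ℕ} {B : ℤ → ℤ → R} (hB : IsExtBand r s B) :
    IsExtBand s r (fun l j => op (B j l)) where
  zero_upper l j hl hj h := by simp [hB.zero_lower j l hj hl h]
  zero_lower l j hl hj h := by simp [hB.zero_upper j l hj hl h]
  neg_row l j hl hj := by rw [hB.neg_col j l hj hl]; split_ifs <;> simp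
  neg_col l j hl hj := by rw [hB.neg_row j l hj hl]; split_ifs <;> simp
  isUnit_upper l hl := (hB.isUnit_lower l hl).op
  isUnit_lower j hj := (hB.isUnit_upper j hj).op

/-- The `j`-th entry of the product of the band matrix `B` with the column `Y`. -/
def rowSum (r s : ℕ) (B : ℤ → ℤ → R) (Y : ℤ → R) (j : ℤ) : R :=
  ∑ l ∈ Finset.Icc (j - s) (j + r), B j l * Y l

theorem sum_Icc_eq_sum_range {M : Type*} [AddCommMonoid M] (F : ℤ → M) (a : ℤ) (n : ℕ) :
    ∑ l ∈ Finset.Icc a (a + n), F l = ∑ i ∈ Finset.range (n + 1), F (a + i) := by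
  symm
  refine Finset.sum_nbij' (fun i : ℕ => a + i) (fun l => (l - a).toNat) ?_ ?_ ?_ ?_ ?_
  · intro i hi; simp at hi ⊢; omega
  · intro l hl; simp at hl ⊢; omega
  · intro i hi; simp
  · intro l hl; simp at hl ⊢; omega
  · intro i hi; rfl

theorem rowSum_eq_sum_range (r s : ℕ) (B : ℤ → ℤ → R) (Y : ℤ → R) (j : ℤ) :
    rowSum r s B Y j = ∑ i ∈ Finset.range (s + r + 1), B j (j - s + i) * Y (j - s + i) := by
  rw [rowSum, show j + (r : ℤ) = j - s + ((s + r : ℕ) : ℤ) by push_cast; ring,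
    sum_Icc_eq_sum_range (fun l => B j l * Y l)]

theorem IsExtBand.eq_zero {r s : ℕ} {B : ℤ → ℤ → R} (hB : IsExtBand r s B) {j l : ℤ}
    (hj : 0 ≤ j) (hl : l ∉ Finset.Icc (j - (s : ℤ)) (j + r)) : B j l = 0 := by
  rw [Finset.mem_Icc] at hl
  rcases lt_or_ge l 0 with h | h
  · rw [hB.neg_col j l hj h, if_neg (by omega)]
  · by_cases h' : j + r < l
    · exact hB.zero_upper j l hj h h'
    · exact hB.zero_lower j l hj h (by omega)

theorem IsExtBand.rowSum_eq {r s : ℕ} {B : ℤ → ℤ → R} (hB : IsExtBand r s B) (Y : ℤ → R)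
    {j a b : ℤ} (hj : 0 ≤ j) (ha : a ≤ j - s) (hb : j + r ≤ b) :
    rowSum r s B Y j = ∑ l ∈ Finset.Icc a b, B j l * Y l := by
  refine Finset.sum_subset (Finset.Icc_subset_Icc ha hb) fun l _ hl => ?_
  rw [hB.eq_zero hj hl, zero_mul]

theorem rowSum_single {r s : ℕ} {B : ℤ → ℤ → R} (hB : IsExtBand r s B) {j : ℤ} (hj : 0 ≤ j)
    (l : ℤ) : rowSum r s B (fun k => if k = l then 1 else 0) j = B j l := by
  simp only [rowSum, mul_ite, mul_one, mul_zero, Finset.sum_ite_eq']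
  split_ifs with h
  · rfl
  · exact (hB.eq_zero hj h).symm

theorem rowSum_add (r s : ℕ) (B : ℤ → ℤ → R) (Y Z : ℤ → R) (j : ℤ) :
    rowSum r s B (fun k => Y k + Z k) j = rowSum r s B Y j + rowSum r s B Z j := by
  simp [rowSum, mul_add, Finset.sum_add_distrib]

theorem rowSum_sub (r s : ℕ) (B : ℤ → ℤ → R) (Y Z : ℤ → R) (j : ℤ) :
    rowSum r s B (fun k => Y k - Z k) j = rowSum r s B Y j - rowSum r s B Z j := by
  simp [rowSum, mul_sub, Finset.sum_sub_distrib]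

theorem rowSum_sum {ι : Type*} (r s : ℕ) (B : ℤ → ℤ → R) (t : Finset ι) (Y : ι → ℤ → R)
    (j : ℤ) : rowSum r s B (fun k => ∑ i ∈ t, Y i k) j = ∑ i ∈ t, rowSum r s B (Y i) j := by
  simp only [rowSum, Finset.mul_sum]
  exact Finset.sum_comm

theorem rowSum_mul (r s : ℕ) (B : ℤ → ℤ → R) (Y : ℤ → R) (c : R) (j : ℤ) :
    rowSum r s B (fun k => Y k * c) j = rowSum r s B Y j * c := by
  simp [rowSum, Finset.sum_mul, mul_assoc]

theorem rowSum_dotProduct {ι : Type*} [Fintype ι] (r s : ℕ) (B : ℤ → ℤ → R)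
    (Y : ℤ → ι → R) (c : ι → R) (j : ℤ) (h : ∀ i, rowSum r s B (fun k => Y k i) j = 0) :
    rowSum r s B (fun k => Y k ⬝ᵥ c) j = 0 := by
  simp only [dotProduct, rowSum_sum, rowSum_mul, h, zero_mul, Finset.sum_const_zero]

/-- Row `k - r` determines `Y k` from earlier values, since its outermost entry is invertible. The
cutoff `K` allows equations that are homogeneous only up to some row, which yields the support of
`green`. -/
theorem IsExtBand.eq_zero_of_rowSum {r s : ℕ} {B : ℤ → ℤ → R} (hB : IsExtBand r s B)
    {Y : ℤ → R} {K : ℤ} (hinit : ∀ k, -(s : ℤ) ≤ k → k < r → k < K → Y k = 0)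
    (hrow : ∀ j, 0 ≤ j → j + r < K → rowSum r s B Y j = 0) :
    ∀ k, -(s : ℤ) ≤ k → k < K → Y k = 0 := by
  have key (m : ℕ) : ∀ k, -(s : ℤ) ≤ k → k + s < m → k < K → Y k = 0 := by
    induction m with
    | zero => intro k h1 h2; push_cast at h2; omega
    | succ m ih =>
      intro k h1 h2 h3
      push_cast at h2
      by_cases hk : k < r
      · exact hinit k h1 hk h3
      have h := hrow (k - r) (by omega) (by omega)
      rw [rowSum, Finset.sum_eq_single_of_mem k (by simp; omega)] at h
      · have hu := hB.isUnit_upper (k - r) (by omega)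
        rw [sub_add_cancel] at hu
        exact hu.mul_right_eq_zero.1 h
      · intro l hl hlk
        rw [Finset.mem_Icc] at hl
        rw [ih l (by omega) (by omega) (by omega), mul_zero]
  exact fun k h1 h2 => key (k + s + 1).toNat k h1 (by omega) h2

theorem IsExtBand.eq_zero_of_rowSum' {r s : ℕ} {B : ℤ → ℤ → R} (hB : IsExtBand r s B)
    {Y : ℤ → R} (hinit : ∀ k, -(s : ℤ) ≤ k → k < r → Y k = 0)
    (hrow : ∀ j, 0 ≤ j → rowSum r s B Y j = 0) {k : ℤ} (hk : -(s : ℤ) ≤ k) : Y k = 0 :=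
  hB.eq_zero_of_rowSum (K := k + 1) (fun k h h' _ => hinit k h h') (fun j h _ => hrow j h) k hk
    (by omega)

/-- The solution of `B Y = f` with initial values `Y_k = c k`, `k < r`. -/
def inhomSol (r s : ℕ) (B : ℤ → ℤ → R) (f c : ℤ → R) (k : ℤ) : R :=
  if k < r then c k
  else Ring.inverse (B (k - r) k) * (f (k - r) - ∑ i : Fin (s + r),
    B (k - r) (k - r - s + (i : ℕ)) * inhomSol r s B f c (k - r - s + (i : ℕ)))
termination_by (k + s).toNat
decreasing_by omega

theorem inhomSol_of_lt {r s : ℕ} (B : ℤ → ℤ → R) (f c : ℤ → R) {k : ℤ} (hk : k < r) :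
    inhomSol r s B f c k = c k := by
  rw [inhomSol, if_pos hk]

theorem IsExtBand.rowSum_inhomSol {r s : ℕ} {B : ℤ → ℤ → R} (hB : IsExtBand r s B)
    (f c : ℤ → R) {j : ℤ} (hj : 0 ≤ j) : rowSum r s B (inhomSol r s B f c) j = f j := by
  have e : inhomSol r s B f c (j + r) = Ring.inverse (B j (j + r)) *
      (f j - ∑ i ∈ Finset.range (s + r), B j (j - s + i) * inhomSol r s B f c (j - s + i)) := by
    rw [inhomSol, if_neg (by omega), ← Fin.sum_univ_eq_sum_range
      (fun i => B j (j - s + i) * inhomSol r s B f c (j - s + i))]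
    simp only [add_sub_cancel_right]
  rw [rowSum_eq_sum_range, Finset.sum_range_succ,
    show j - s + ((s + r : ℕ) : ℤ) = j + r by push_cast; ring, e, ← mul_assoc,
    Ring.mul_inverse_cancel _ (hB.isUnit_upper j hj), one_mul]
  abel

/-- The inverse of `-B` supported on `k ≥ n + r`. -/
def green (r s : ℕ) (B : ℤ → ℤ → R) (k n : ℤ) : R :=
  inhomSol r s B (fun j => if j = n then -1 else 0) (fun k => if k = n + r then 1 else 0) k

/-- For `-r ≤ n < 0` there is no equation to carry the source; the initial value replaces it. It is
the value forced by row `n` of `B`, whose entry in column `n + r` is `-1`. -/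
theorem green_of_lt {r s : ℕ} (B : ℤ → ℤ → R) {k : ℤ} (hk : k < r) (n : ℤ) :
    green r s B k n = if k = n + r then 1 else 0 :=
  inhomSol_of_lt _ _ _ hk

theorem IsExtBand.rowSum_green {r s : ℕ} {B : ℤ → ℤ → R} (hB : IsExtBand r s B) {j : ℤ}
    (hj : 0 ≤ j) (n : ℤ) :
    rowSum r s B (fun k => green r s B k n) j = if j = n then -1 else 0 :=
  hB.rowSum_inhomSol _ _ hj

theorem IsExtBand.green_eq_zero {r s : ℕ} {B : ℤ → ℤ → R} (hB : IsExtBand r s B) {k n : ℤ}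
    (hk : -(s : ℤ) ≤ k) (h : k < n + r) : green r s B k n = 0 := by
  refine hB.eq_zero_of_rowSum (Y := fun k => green r s B k n) (K := n + r) ?_ ?_ k hk h
  · intro k _ h1 h2
    rw [green_of_lt B h1, if_neg (by omega)]
  · intro j h1 h2
    rw [hB.rowSum_green h1, if_neg (by omega)]

/-- A right inverse of `-B` is also a left inverse: as a function of `k`, the product plus the
identity solves the homogeneous row equations with zero initial data. -/
theorem IsExtBand.green_mul {r s : ℕ} {B : ℤ → ℤ → R} (hB : IsExtBand r s B) {k l : ℤ}
    (hk : -(s : ℤ) ≤ k) (hl : 0 ≤ l) :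
    ∑ n ∈ Finset.Icc (l - r) (l + s), green r s B k n * B n l = if k = l then -1 else 0 := by
  have h : ∑ n ∈ Finset.Icc (l - (r : ℤ)) (l + s), green r s B k n * B n l +
      (if k = l then 1 else 0) = 0 := by
    refine hB.eq_zero_of_rowSum' (Y := fun k => ∑ n ∈ Finset.Icc (l - (r : ℤ)) (l + s),
      green r s B k n * B n l + (if k = l then 1 else 0)) ?_ ?_ hk
    · intro k _ hk
      have e (n : ℤ) : green r s B k n * B n l = if n = k - r then B n l else 0 := by
        rw [green_of_lt B hk]
        by_cases h : k = n + r
        · simp [h]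
        · rw [if_neg h, if_neg (by omega), zero_mul]
      simp only [e, Finset.sum_ite_eq', Finset.mem_Icc]
      -- Only `n = k - r < 0` contributes, and that row of `B` has its single `-1` in column `k`.
      rw [hB.neg_row _ _ (by omega) hl]
      by_cases h : k = l
      · rw [if_pos (by omega), if_pos (by omega), if_pos h]; simp
      · rw [if_neg (show ¬ l = k - r + r by omega), if_neg h]; simp
    · intro j hj
      rw [rowSum_add, rowSum_sum, rowSum_single hB hj]
      simp only [rowSum_mul, hB.rowSum_green hj, ite_mul, zero_mul, neg_mul, one_mul,
        Finset.sum_ite_eq]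
      split_ifs with h
      · simp
      · rw [zero_add]
        rw [Finset.mem_Icc] at h
        by_cases h' : j + r < l
        · exact hB.zero_upper j l hj hl h'
        · exact hB.zero_lower j l hj hl (by omega)
  rw [eq_neg_of_add_eq_zero_left h]
  split_ifs <;> simp

/-- The inverse of `-B` supported on `n ≥ k + s`. -/
def greenOp (r s : ℕ) (B : ℤ → ℤ → R) (k n : ℤ) : R :=
  unop (green s r (fun l j => op (B j l)) n k)

/-- The `l`-th entry of the product of the row `Z` with the band matrix `B`. -/
def colSum (r s : ℕ) (B : ℤ → ℤ → R) (Z : ℤ → R) (l : ℤ) : R :=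
  ∑ n ∈ Finset.Icc (l - r) (l + s), Z n * B n l

theorem op_colSum (r s : ℕ) (B : ℤ → ℤ → R) (Z : ℤ → R) (l : ℤ) :
    op (colSum r s B Z l) = rowSum s r (fun l j => op (B j l)) (fun n => op (Z n)) l := by
  simp [colSum, rowSum]

theorem colSum_eq_unop (r s : ℕ) (B : ℤ → ℤ → R) (Z : ℤ → R) (l : ℤ) :
    colSum r s B Z l = unop (rowSum s r (fun l j => op (B j l)) (fun n => op (Z n)) l) := by
  rw [← op_colSum, unop_op]

theorem colSum_add (r s : ℕ) (B : ℤ → ℤ → R) (Y Z : ℤ → R) (j : ℤ) :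
    colSum r s B (fun k => Y k + Z k) j = colSum r s B Y j + colSum r s B Z j := by
  simp [colSum, add_mul, Finset.sum_add_distrib]

theorem colSum_sub (r s : ℕ) (B : ℤ → ℤ → R) (Y Z : ℤ → R) (j : ℤ) :
    colSum r s B (fun k => Y k - Z k) j = colSum r s B Y j - colSum r s B Z j := by
  simp [colSum, sub_mul, Finset.sum_sub_distrib]

theorem colSum_dotProduct {ι : Type*} [Fintype ι] (r s : ℕ) (B : ℤ → ℤ → R)
    (Z : ℤ → ι → R) (c : ι → R) (l : ℤ) (h : ∀ i, colSum r s B (fun k => Z k i) l = 0) :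
    colSum r s B (fun k => c ⬝ᵥ Z k) l = 0 := by
  simp only [dotProduct, colSum, Finset.sum_mul, mul_assoc] at h ⊢
  rw [Finset.sum_comm]
  simp only [← Finset.mul_sum, h, mul_zero, Finset.sum_const_zero]

theorem IsExtBand.colSum_eq {r s : ℕ} {B : ℤ → ℤ → R} (hB : IsExtBand r s B) (Z : ℤ → R)
    {l a b : ℤ} (hl : 0 ≤ l) (ha : a ≤ l - r) (hb : l + s ≤ b) :
    colSum r s B Z l = ∑ n ∈ Finset.Icc a b, Z n * B n l := by
  rw [colSum_eq_unop, hB.opposite.rowSum_eq _ hl ha hb]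
  simp

theorem IsExtBand.eq_zero_of_colSum {r s : ℕ} {B : ℤ → ℤ → R} (hB : IsExtBand r s B)
    {Z : ℤ → R} (hinit : ∀ n, -(r : ℤ) ≤ n → n < s → Z n = 0)
    (hcol : ∀ l, 0 ≤ l → colSum r s B Z l = 0) {n : ℤ} (hn : -(r : ℤ) ≤ n) : Z n = 0 := by
  refine op_injective ?_
  refine hB.opposite.eq_zero_of_rowSum' (Y := fun n => op (Z n)) ?_ ?_ hn
  · intro n h1 h2; simp [hinit n h1 h2]
  · intro l hl; rw [← op_colSum, hcol l hl, op_zero]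

theorem greenOp_of_lt {r s : ℕ} (B : ℤ → ℤ → R) {n : ℤ} (hn : n < s) (k : ℤ) :
    greenOp r s B k n = if n = k + s then 1 else 0 := by
  rw [greenOp, green_of_lt _ hn]
  split_ifs <;> simp

theorem IsExtBand.greenOp_eq_zero {r s : ℕ} {B : ℤ → ℤ → R} (hB : IsExtBand r s B) {k n : ℤ}
    (hn : -(r : ℤ) ≤ n) (h : n < k + s) : greenOp r s B k n = 0 := by
  rw [greenOp, hB.opposite.green_eq_zero hn h, unop_zero]

theorem IsExtBand.colSum_greenOp {r s : ℕ} {B : ℤ → ℤ → R} (hB : IsExtBand r s B) {l : ℤ}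
    (hl : 0 ≤ l) (k : ℤ) :
    colSum r s B (greenOp r s B k) l = if l = k then -1 else 0 := by
  have := hB.opposite.rowSum_green hl k
  rw [colSum_eq_unop]
  simp only [greenOp, op_unop]
  rw [this]
  split_ifs <;> simp

theorem IsExtBand.rowSum_greenOp {r s : ℕ} {B : ℤ → ℤ → R} (hB : IsExtBand r s B) {n j : ℤ}
    (hn : -(r : ℤ) ≤ n) (hj : 0 ≤ j) :
    rowSum r s B (fun k => greenOp r s B k n) j = if n = j then -1 else 0 := by
  have := congrArg unop (hB.opposite.green_mul hn hj)
  rw [Finset.unop_sum] at this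
  simp only [unop_mul, unop_op] at this
  rw [rowSum]
  simp only [greenOp]
  rw [this]
  split_ifs <;> simp

/-- A function of two indices which solves both homogeneous equations is determined by its
initial block. -/
theorem IsExtBand.eq_green_sub_greenOp {r s : ℕ} {B : ℤ → ℤ → R} (hB : IsExtBand r s B)
    {W : ℤ → ℤ → R}
    (hrow : ∀ n j, 0 ≤ j → rowSum r s B (fun k => W k n) j = 0)
    (hcol : ∀ k l, 0 ≤ l → colSum r s B (W k) l = 0)
    (hinit : ∀ k n, -(s : ℤ) ≤ k → k < r → -(r : ℤ) ≤ n → n < s →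
      W k n = (if k = n + r then 1 else 0) - (if n = k + s then 1 else 0))
    {k n : ℤ} (hk : -(s : ℤ) ≤ k) (hn : -(r : ℤ) ≤ n) :
    W k n = green r s B k n - greenOp r s B k n := by
  -- For `n` in the initial range the row recursion in `k` settles the claim; the column recursion
  -- in `n` then extends it to all `n`.
  have h1 (n : ℤ) (hn : -(r : ℤ) ≤ n) (hns : n < s) {k : ℤ} (hk : -(s : ℤ) ≤ k) :
      W k n - (green r s B k n - greenOp r s B k n) = 0 := by
    refine hB.eq_zero_of_rowSum'
      (Y := fun k => W k n - (green r s B k n - greenOp r s B k n)) ?_ ?_ hk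
    · intro k h1 h2
      simp only [hinit k n h1 h2 hn hns, green_of_lt B h2, greenOp_of_lt B hns, sub_self]
    · intro j hj
      rw [rowSum_sub, rowSum_sub, hrow n j hj, hB.rowSum_green hj, hB.rowSum_greenOp hn hj]
      simp [eq_comm]
  refine sub_eq_zero.1 ?_
  refine hB.eq_zero_of_colSum (Z := fun n => W k n - (green r s B k n - greenOp r s B k n))
    (fun n h1' h2 => h1 n h1' h2 hk) ?_ hn
  intro l hl
  have hg : colSum r s B (green r s B k) l = _ := hB.green_mul hk hl
  rw [colSum_sub r s B (W k), colSum_sub r s B (green r s B k), hcol k l hl, hg,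
    hB.colSum_greenOp hl]
  simp [eq_comm]

end Green

/-! ### The kernel as a formal two-sided inverse of `λ - A`. -/

section Identities

variable {N r s : ℕ} {A : ℕ → ℕ → Blk N}

/-- The matrix `A - λ I`, with `A` extended to negative indices. -/
def shiftedExtMat (r s : ℕ) (A : ℕ → ℕ → Blk N) (lam : ℂ) (j l : ℤ) : Blk N :=
  extMat r s A j l - if j = l then lam • 1 else 0

theorem shiftedExtMat_natCast (lam : ℂ) (j l : ℕ) :
    shiftedExtMat r s A lam j l = A j l - if j = l then lam • 1 else 0 := by
  simp [shiftedExtMat, extMat]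

/-- Since `r, s ≥ 1`, subtracting `λ` from the diagonal leaves the outer diagonals and their
continuation unchanged. -/
theorem isExtBand_shiftedExtMat (hr : 1 ≤ r) (hs : 1 ≤ s) (hA : IsBand r s A) (lam : ℂ) :
    IsExtBand r s (shiftedExtMat r s A lam) where
  zero_upper j l hj hl h := by
    lift j to ℕ using hj
    lift l to ℕ using hl
    rw [shiftedExtMat_natCast, hA.zero_upper j l (by omega), if_neg (by omega), sub_zero]
  zero_lower j l hj hl h := by
    lift j to ℕ using hj
    lift l to ℕ using hl
    rw [shiftedExtMat_natCast, hA.zero_lower j l (by omega), if_neg (by omega), sub_zero]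
  neg_row j l hj hl := by
    rw [shiftedExtMat, extMat, if_neg (by omega), if_neg (show ¬ j = l by omega), sub_zero]
    exact if_congr (by omega) rfl rfl
  neg_col j l hj hl := by
    rw [shiftedExtMat, extMat, if_neg (by omega), if_neg (show ¬ j = l by omega), sub_zero]
    exact if_congr (by omega) rfl rfl
  isUnit_upper j hj := by
    lift j to ℕ using hj
    rw [← Nat.cast_add, shiftedExtMat_natCast, if_neg (by omega), sub_zero]
    exact hA.isUnit_upper j
  isUnit_lower l hl := by
    lift l to ℕ using hl
    rw [← Nat.cast_add, shiftedExtMat_natCast, if_neg (by omega), sub_zero]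
    exact hA.isUnit_lower l

theorem IsSol.rowSum_eq_zero {lam : ℂ} {Y : ℤ → Blk N} (hY : IsSol r s A lam Y) {j : ℤ}
    (hj : 0 ≤ j) : rowSum r s (shiftedExtMat r s A lam) Y j = 0 := by
  have h := hY j hj
  rw [← rowSum_eq_sum_range r s (extMat r s A) Y] at h
  simp only [rowSum, shiftedExtMat, sub_mul, Finset.sum_sub_distrib] at h ⊢
  rw [h]
  simp [ite_mul]

theorem IsDualSol.colSum_eq_zero {lam : ℂ} {Y : ℤ → Blk N} (hY : IsDualSol r s A lam Y) {l : ℤ}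
    (hl : 0 ≤ l) : colSum r s (shiftedExtMat r s A lam) Y l = 0 := by
  have h := hY l hl
  have e := sum_Icc_eq_sum_range (fun n => Y n * extMat r s A n l) (l - r) (r + s)
  rw [show l - (r : ℤ) + ((r + s : ℕ) : ℤ) = l + s by push_cast; ring] at e
  rw [← e] at h
  simp only [colSum, shiftedExtMat, mul_sub, Finset.sum_sub_distrib] at h ⊢
  rw [h]
  simp [mul_ite]

theorem sol_of_lt (lam : ℂ) (c : ℤ → Blk N) {k : ℤ} (hk : k < r) : sol r s A lam c k = c k := by
  rw [sol, if_pos hk]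

theorem dualSol_of_lt (lam : ℂ) (c : ℤ → Blk N) {k : ℤ} (hk : k < s) :
    dualSol r s A lam c k = c k := by
  rw [dualSol, if_pos hk]

theorem Q_of_lt (lam : ℂ) {k : ℤ} (hk : k < r) (i : Fin r) :
    Q r s A lam k i = if k = (i : ℕ) then 1 else 0 := sol_of_lt _ _ hk

theorem P_of_lt (lam : ℂ) {k : ℤ} (hk : k < r) (i : Fin s) :
    P r s A lam k i = if k = (i : ℕ) - (s : ℤ) then 1 else 0 := sol_of_lt _ _ hk

theorem Qplus_of_lt (lam : ℂ) {k : ℤ} (hk : k < s) (i : Fin s) :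
    Qplus r s A lam k i = if k = (i : ℕ) then 1 else 0 := dualSol_of_lt _ _ hk

theorem Pplus_of_lt (lam : ℂ) {k : ℤ} (hk : k < s) (i : Fin r) :
    Pplus r s A lam k i = if k = (i : ℕ) - (r : ℤ) then 1 else 0 := dualSol_of_lt _ _ hk

theorem sum_ite_fin {M : Type*} [AddCommMonoid M] {d : ℕ} (k : ℤ) (x : M) :
    ∑ i : Fin d, (if k = (i : ℕ) then x else 0) = if 0 ≤ k ∧ k < d then x else 0 := by
  by_cases h : 0 ≤ k ∧ k < d
  · obtain ⟨h0, h1⟩ := h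
    lift k to ℕ using h0
    rw [Finset.sum_eq_single ⟨k, by omega⟩ (fun i _ hi => if_neg fun h => hi (Fin.ext (by
      simp; omega))) (by simp), if_pos rfl, if_pos (by omega)]
  · rw [if_neg h]
    exact Finset.sum_eq_zero fun i _ => if_neg (by omega)

theorem Q_dotProduct_Pplus_sub_P_dotProduct_Qplus (lam : ℂ) {k n : ℤ} (hk : -(s : ℤ) ≤ k)
    (hkr : k < r) (hn : -(r : ℤ) ≤ n) (hns : n < s) :
    Q r s A lam k ⬝ᵥ Pplus r s A lam n - P r s A lam k ⬝ᵥ Qplus r s A lam n =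
      (if k = n + r then 1 else 0) - (if n = k + s then 1 else 0) := by
  have e1 : ∀ i : Fin r, (if k = (i : ℕ) then (1 : Blk N) else 0) *
      (if n = (i : ℕ) - (r : ℤ) then 1 else 0) =
      if k = (i : ℕ) then (if k = n + r then 1 else 0) else 0 := by
    intro i
    split_ifs <;> first | omega | simp
  have e2 : ∀ i : Fin s, (if k = (i : ℕ) - (s : ℤ) then (1 : Blk N) else 0) *
      (if n = (i : ℕ) then 1 else 0) =
      if n = (i : ℕ) then (if n = k + s then 1 else 0) else 0 := by
    intro i
    split_ifs <;> first | omega | simp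
  simp only [dotProduct, Q_of_lt lam hkr, P_of_lt lam hkr, Qplus_of_lt lam hns,
    Pplus_of_lt lam hns, e1, e2, sum_ite_fin]
  congr 1 <;> split_ifs <;> first | omega | rfl

theorem rowSum_Q_dotProduct (hr : 1 ≤ r) (hA : IsBand r s A) (lam : ℂ) (c : Fin r → Blk N)
    {j : ℤ} (hj : 0 ≤ j) :
    rowSum r s (shiftedExtMat r s A lam) (fun k => Q r s A lam k ⬝ᵥ c) j = 0 :=
  rowSum_dotProduct _ _ _ _ _ _ fun _ => (isSol_sol hr hA lam _).rowSum_eq_zero hj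

theorem rowSum_P_dotProduct (hr : 1 ≤ r) (hA : IsBand r s A) (lam : ℂ) (c : Fin s → Blk N)
    {j : ℤ} (hj : 0 ≤ j) :
    rowSum r s (shiftedExtMat r s A lam) (fun k => P r s A lam k ⬝ᵥ c) j = 0 :=
  rowSum_dotProduct _ _ _ _ _ _ fun _ => (isSol_sol hr hA lam _).rowSum_eq_zero hj

theorem colSum_dotProduct_Qplus (hs : 1 ≤ s) (hA : IsBand r s A) (lam : ℂ) (c : Fin s → Blk N)
    {l : ℤ} (hl : 0 ≤ l) :
    colSum r s (shiftedExtMat r s A lam) (fun n => c ⬝ᵥ Qplus r s A lam n) l = 0 :=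
  colSum_dotProduct _ _ _ _ _ _ fun _ => (isDualSol_dualSol hs hA lam _).colSum_eq_zero hl

theorem colSum_dotProduct_Pplus (hs : 1 ≤ s) (hA : IsBand r s A) (lam : ℂ) (c : Fin r → Blk N)
    {l : ℤ} (hl : 0 ≤ l) :
    colSum r s (shiftedExtMat r s A lam) (fun n => c ⬝ᵥ Pplus r s A lam n) l = 0 :=
  colSum_dotProduct _ _ _ _ _ _ fun _ => (isDualSol_dualSol hs hA lam _).colSum_eq_zero hl

variable (A) in
/-- The two expressions for the kernel differ by the difference of the two one-sided Green
functions. -/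
theorem Rrow_dotProduct_sub_dotProduct_Rcol (hr : 1 ≤ r) (hs : 1 ≤ s) (hA : IsBand r s A)
    (lam : ℂ) (M : Matrix (Fin r) (Fin s) (Blk N)) {k n : ℤ} (hk : -(s : ℤ) ≤ k)
    (hn : -(r : ℤ) ≤ n) :
    Rrow A lam M k ⬝ᵥ Qplus r s A lam n - Q r s A lam k ⬝ᵥ Rcol A lam M n =
      green r s (shiftedExtMat r s A lam) k n - greenOp r s (shiftedExtMat r s A lam) k n := by
  rw [← (isExtBand_shiftedExtMat hr hs hA lam).eq_green_sub_greenOp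
    (W := fun k n => Q r s A lam k ⬝ᵥ Pplus r s A lam n - P r s A lam k ⬝ᵥ Qplus r s A lam n)
    ?_ ?_ ?_ hk hn]
  -- The terms containing `M` cancel by associativity.
  · rw [Rrow, Rcol, sub_dotProduct, dotProduct_sub, Matrix.dotProduct_mulVec]
    abel
  · intro n j hj
    rw [rowSum_sub, rowSum_Q_dotProduct hr hA lam _ hj, rowSum_P_dotProduct hr hA lam _ hj,
      sub_zero]
  · intro k l hl
    rw [colSum_sub, colSum_dotProduct_Pplus hs hA lam _ hl,
      colSum_dotProduct_Qplus hs hA lam _ hl, sub_zero]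
  · exact fun k n h1 h2 h3 h4 => Q_dotProduct_Pplus_sub_P_dotProduct_Qplus lam h1 h2 h3 h4

/-- `green` vanishes for `k < n + r`; for `k ≥ n + r` one has `n < k + s`, so `greenOp` vanishes and
`green` is the whole difference of the two expressions. -/
theorem kernelR_eq_add_green (hr : 1 ≤ r) (hs : 1 ≤ s) (hA : IsBand r s A) (lam : ℂ)
    (M : Matrix (Fin r) (Fin s) (Blk N)) (k n : ℕ) :
    kernelR A lam M k n = Q r s A lam k ⬝ᵥ Rcol A lam M n +
      green r s (shiftedExtMat r s A lam) k n := by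
  have hB := isExtBand_shiftedExtMat hr hs hA lam
  rw [kernelR]
  split_ifs with h
  · rw [hB.green_eq_zero (by omega) (by omega), add_zero]
  · have := Rrow_dotProduct_sub_dotProduct_Rcol A hr hs hA lam M (k := k) (n := n) (by omega)
      (by omega)
    rw [hB.greenOp_eq_zero (by omega) (by omega), sub_zero] at this
    rw [← this]
    abel

theorem kernelR_eq_add_greenOp (hr : 1 ≤ r) (hs : 1 ≤ s) (hA : IsBand r s A) (lam : ℂ)
    (M : Matrix (Fin r) (Fin s) (Blk N)) (k n : ℕ) :
    kernelR A lam M k n = Rrow A lam M k ⬝ᵥ Qplus r s A lam n +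
      greenOp r s (shiftedExtMat r s A lam) k n := by
  have := Rrow_dotProduct_sub_dotProduct_Rcol A hr hs hA lam M (k := k) (n := n) (by omega)
      (by omega)
  rw [kernelR_eq_add_green hr hs hA, sub_eq_iff_eq_add.1 this]
  abel

theorem kernelR_eq_Rrow_dotProduct (hr : 1 ≤ r) (hs : 1 ≤ s) (hA : IsBand r s A) (lam : ℂ)
    (M : Matrix (Fin r) (Fin s) (Blk N)) {k n : ℕ} (h : n < k + s) :
    kernelR A lam M k n = Rrow A lam M k ⬝ᵥ Qplus r s A lam n := by
  rw [kernelR_eq_add_greenOp hr hs hA, (isExtBand_shiftedExtMat hr hs hA lam).greenOp_eq_zero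
    (by omega) (by omega), add_zero]

theorem sum_Icc_eq_sum_range_of_neg {M : Type*} [AddCommMonoid M] {F : ℤ → M} {a : ℤ}
    (ha : a ≤ 0) (hF : ∀ l, a ≤ l → l < 0 → F l = 0) (b : ℕ) :
    ∑ l ∈ Finset.Icc a (b : ℤ), F l = ∑ i ∈ Finset.range (b + 1), F i := by
  have h := sum_Icc_eq_sum_range F 0 b
  simp only [zero_add] at h
  rw [← h]
  symm
  refine Finset.sum_subset (Finset.Icc_subset_Icc_left ha) fun l hl hl' => ?_
  rw [Finset.mem_Icc] at hl hl'
  exact hF l hl.1 (by omega)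

theorem kernelR_row_identity (hr : 1 ≤ r) (hs : 1 ≤ s) (hA : IsBand r s A) (lam : ℂ)
    (M : Matrix (Fin r) (Fin s) (Blk N)) (k n : ℕ) :
    ∑ l ∈ Finset.range (k + r + 1), A k l * kernelR A lam M l n =
      lam • kernelR A lam M k n - if k = n then 1 else 0 := by
  have hB := isExtBand_shiftedExtMat hr hs hA lam
  have h : rowSum r s (shiftedExtMat r s A lam)
      (fun l => Q r s A lam l ⬝ᵥ Rcol A lam M n +
        green r s (shiftedExtMat r s A lam) l n) k = if k = n then -1 else 0 := by
    rw [rowSum_add, rowSum_Q_dotProduct hr hA lam _ (by omega), hB.rowSum_green (by omega),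
      zero_add]
    exact if_congr (by omega) rfl rfl
  rw [hB.rowSum_eq (a := -s) (b := ((k + r : ℕ) : ℤ)) _ (by omega) (by omega) (by simp),
    sum_Icc_eq_sum_range_of_neg (by omega)] at h
  · simp only [← kernelR_eq_add_green hr hs hA, shiftedExtMat_natCast, sub_mul, ite_mul, zero_mul,
      Finset.sum_sub_distrib, Finset.sum_ite_eq, smul_mul_assoc, one_mul, Finset.mem_range] at h
    rw [if_pos (by omega), sub_eq_iff_eq_add] at h
    rw [h]
    split_ifs <;> abel
  -- At negative `l` both `Q` and `green` vanish, so the extension of `A` to negative indices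
  -- contributes nothing.
  · intro l h1 h2
    rw [hB.green_eq_zero h1 (by omega), add_zero, dotProduct]
    rw [Finset.sum_eq_zero, mul_zero]
    intro i _
    rw [Q_of_lt lam (by omega), if_neg (by omega), zero_mul]

theorem kernelR_col_identity (hr : 1 ≤ r) (hs : 1 ≤ s) (hA : IsBand r s A) (lam : ℂ)
    (M : Matrix (Fin r) (Fin s) (Blk N)) (k n : ℕ) :
    ∑ l ∈ Finset.range (n + s + 1), kernelR A lam M k l * A l n =
      lam • kernelR A lam M k n - if k = n then 1 else 0 := by
  have hB := isExtBand_shiftedExtMat hr hs hA lam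
  have h : colSum r s (shiftedExtMat r s A lam)
      (fun l => Rrow A lam M k ⬝ᵥ Qplus r s A lam l +
        greenOp r s (shiftedExtMat r s A lam) k l) n = if k = n then -1 else 0 := by
    rw [colSum_add, colSum_dotProduct_Qplus hs hA lam _ (by omega),
      hB.colSum_greenOp (by omega), zero_add]
    exact if_congr (by omega) rfl rfl
  rw [hB.colSum_eq (a := -r) (b := ((n + s : ℕ) : ℤ)) _ (by omega) (by omega) (by simp),
    sum_Icc_eq_sum_range_of_neg (by omega)] at h
  · simp only [← kernelR_eq_add_greenOp hr hs hA, shiftedExtMat_natCast, mul_sub, mul_ite,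
      mul_zero, Finset.sum_sub_distrib, Finset.sum_ite_eq', mul_smul_comm, mul_one,
      Finset.mem_range] at h
    rw [if_pos (by omega), sub_eq_iff_eq_add] at h
    rw [h]
    split_ifs <;> abel
  · intro l h1 h2
    rw [hB.greenOp_eq_zero h1 (by omega), add_zero, dotProduct]
    rw [Finset.sum_eq_zero, zero_mul]
    intro i _
    rw [Qplus_of_lt lam (by omega), if_neg (by omega), mul_zero]

theorem kernelR_corner (lam : ℂ) (M : Matrix (Fin r) (Fin s) (Blk N)) (i : Fin r) (j : Fin s) :
    kernelR A lam M i j = M i j := by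
  have hi := i.2
  have hj := j.2
  rw [kernelR, if_pos (by omega), dotProduct, Finset.sum_eq_single i _ (by simp),
    Q_of_lt lam (by omega), if_pos rfl, one_mul, Rcol, Pi.sub_apply, Matrix.mulVec, dotProduct,
    Finset.sum_eq_single j _ (by simp), Qplus_of_lt lam (by omega), if_pos rfl, mul_one,
    Pplus_of_lt lam (by omega), if_neg (by omega), sub_zero]
  · intro j' _ h
    rw [Qplus_of_lt lam (by omega), if_neg (by omega), mul_zero]
  · intro i' _ h
    rw [Q_of_lt lam (by omega), if_neg (by omega), zero_mul]

theorem eq_zero_of_row_identity (hr : 1 ≤ r) (hA : IsBand r s A) {lam : ℂ} {y : ℕ → Blk N}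
    (h0 : ∀ i < r, y i = 0)
    (h : ∀ k, ∑ l ∈ Finset.range (k + r + 1), A k l * y l = lam • y k) (k : ℕ) : y k = 0 := by
  induction k using Nat.strong_induction_on with
  | _ k ih =>
    by_cases hk : k < r
    · exact h0 k hk
    obtain ⟨j, rfl⟩ := Nat.exists_eq_add_of_le' (not_lt.1 hk)
    have := h j
    -- As `r ≥ 1`, the term `λ y_j` precedes `y_{j+r}` and is already known to vanish.
    rw [Finset.sum_range_succ, Finset.sum_eq_zero, zero_add, ih j (by omega), smul_zero] at this
    · exact (hA.isUnit_upper j).mul_right_eq_zero.1 this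
    · intro l hl
      rw [ih l (Finset.mem_range.1 hl), mul_zero]

theorem eq_zero_of_col_identity (hs : 1 ≤ s) (hA : IsBand r s A) {lam : ℂ} {y : ℕ → Blk N}
    (h0 : ∀ i < s, y i = 0)
    (h : ∀ n, ∑ l ∈ Finset.range (n + s + 1), y l * A l n = lam • y n) (n : ℕ) : y n = 0 := by
  induction n using Nat.strong_induction_on with
  | _ k ih =>
    by_cases hk : k < s
    · exact h0 k hk
    obtain ⟨j, rfl⟩ := Nat.exists_eq_add_of_le' (not_lt.1 hk)
    have := h j
    rw [Finset.sum_range_succ, Finset.sum_eq_zero, zero_add, ih j (by omega), smul_zero] at this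
    · exact (hA.isUnit_lower j).mul_left_eq_zero.1 this
    · intro l hl
      rw [ih l (Finset.mem_range.1 hl), zero_mul]

/-- A two-sided formal inverse of `λ - A` is the kernel built from its upper left block. -/
theorem eq_kernelR (hr : 1 ≤ r) (hs : 1 ≤ s) (hA : IsBand r s A) {lam : ℂ} {G : ℕ → ℕ → Blk N}
    (hrow : ∀ k n, ∑ l ∈ Finset.range (k + r + 1), A k l * G l n =
      lam • G k n - if k = n then 1 else 0)
    (hcol : ∀ k n, ∑ l ∈ Finset.range (n + s + 1), G k l * A l n =
      lam • G k n - if k = n then 1 else 0) (k n : ℕ) :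
    G k n = kernelR A lam (Matrix.of fun (i : Fin r) (j : Fin s) => G i j) k n := by
  set M : Matrix (Fin r) (Fin s) (Blk N) := Matrix.of fun i j => G i j with hM
  -- The corners agree, so row recursion gives equality in the first `s` columns; column recursion
  -- gives the rest.
  have h1 (n : ℕ) (hn : n < s) (k : ℕ) : G k n - kernelR A lam M k n = 0 := by
    refine eq_zero_of_row_identity hr hA (lam := lam)
      (y := fun k => G k n - kernelR A lam M k n) ?_ ?_ k
    · intro i hi
      exact sub_eq_zero.2 (kernelR_corner lam M ⟨i, hi⟩ ⟨n, hn⟩).symm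
    · intro k
      simp only [mul_sub, Finset.sum_sub_distrib, hrow, kernelR_row_identity hr hs hA]
      rw [smul_sub]
      abel
  refine sub_eq_zero.1 (eq_zero_of_col_identity hs hA (lam := lam)
      (y := fun n => G k n - kernelR A lam M k n) (fun n hn => h1 n hn k) ?_ n)
  intro n
  simp only [sub_mul, Finset.sum_sub_distrib, hcol, kernelR_col_identity hr hs hA]
  rw [smul_sub]
  abel

end Identities

/-! ### Matrix entries of bounded operators on `l^2_N`. -/

section Operators

variable {N : ℕ}

theorem apply_lp_single (B : L2Seq N →L[ℂ] L2Seq N) (i j : ℕ) (v : EuclideanSpace ℂ (Fin N)) :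
    B (lp.single 2 j v) i = Matrix.toEuclideanCLM (𝕜 := ℂ) (blockEntry B i j) v := by
  have hv : v = ∑ b, v b • EuclideanSpace.single b (1 : ℂ) := by
    ext a
    simp [Pi.single_apply]
  have h : lp.single 2 j v = (∑ b, v b • lp.single 2 j (EuclideanSpace.single b (1 : ℂ)) :
      L2Seq N) := by
    conv_lhs => rw [hv]
    rw [← lp.singleContinuousLinearMap_apply (𝕜 := ℂ)
      (E := fun _ : ℕ => EuclideanSpace ℂ (Fin N)), map_sum]
    simp
  rw [h, map_sum, lp.coeFn_sum, Finset.sum_apply]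
  ext a
  simp [blockEntry, Matrix.mulVec, dotProduct, mul_comm]

theorem blockEntry_eq_of_apply {B : L2Seq N →L[ℂ] L2Seq N} {i j : ℕ} {X : Blk N}
    (h : ∀ v, B (lp.single 2 j v) i = Matrix.toEuclideanCLM (𝕜 := ℂ) X v) :
    blockEntry B i j = X := by
  refine (Matrix.toEuclideanCLM (n := Fin N) (𝕜 := ℂ)).injective ?_
  ext1 v
  exact (apply_lp_single B i j v).symm.trans (h v)

/-- Sequences supported at one index span a dense subspace, so operator identities may be checked on
entries. -/
theorem ext_blockEntry {B B' : L2Seq N →L[ℂ] L2Seq N}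
    (h : ∀ i j, blockEntry B i j = blockEntry B' i j) : B = B' := by
  refine lp.ext_continuousLinearMap (by simp) fun j => ?_
  ext1 v
  refine lp.ext (funext fun i => ?_)
  simp only [ContinuousLinearMap.comp_apply, lp.singleContinuousLinearMap_apply, apply_lp_single, h]

theorem norm_apply_le (u : L2Seq N) (i : ℕ) : ‖u i‖ ≤ ‖u‖ :=
  lp.norm_apply_le_norm (by simp) u i

theorem norm_toEuclideanCLM_le {X : Blk N} {c : ℝ} (hc : 0 ≤ c)
    (h : ∀ v, ‖Matrix.toEuclideanCLM (𝕜 := ℂ) X v‖ ≤ c * ‖v‖) : ‖X‖ ≤ c := by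
  rw [← Matrix.l2_opNorm_toEuclideanCLM]
  exact ContinuousLinearMap.opNorm_le_bound _ hc h

theorem blockEntry_sub (B B' : L2Seq N →L[ℂ] L2Seq N) (i j : ℕ) :
    blockEntry (B - B') i j = blockEntry B i j - blockEntry B' i j :=
  blockEntry_eq_of_apply fun v => by
    rw [map_sub, sub_apply, sub_apply, lp.coeFn_sub,
      Pi.sub_apply, apply_lp_single, apply_lp_single]

theorem blockEntry_smul (c : ℂ) (B : L2Seq N →L[ℂ] L2Seq N) (i j : ℕ) :
    blockEntry (c • B) i j = c • blockEntry B i j :=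
  blockEntry_eq_of_apply fun v => by
    rw [map_smul, smul_apply, smul_apply, lp.coeFn_smul,
      Pi.smul_apply, apply_lp_single]

theorem blockEntry_one (i j : ℕ) :
    blockEntry (1 : L2Seq N →L[ℂ] L2Seq N) i j = if i = j then 1 else 0 :=
  blockEntry_eq_of_apply fun v => by
    rw [one_apply_eq_self, lp.single_apply]
    split_ifs with h
    · subst h; simp
    · simp [h]

variable {r s : ℕ} {A : ℕ → ℕ → Blk N}

theorem bandOp_apply (hA : IsBand r s A) (hb : IsBdd A) (u : L2Seq N) (k : ℕ) :
    bandOp A hA hb u k =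
      ∑ l ∈ Finset.range (k + r + 1), Matrix.toEuclideanCLM (𝕜 := ℂ) (A k l) (u l) := rfl

theorem blockEntry_bandOp_mul (hA : IsBand r s A) (hb : IsBdd A) (B : L2Seq N →L[ℂ] L2Seq N)
    (k n : ℕ) : blockEntry (bandOp A hA hb * B) k n =
      ∑ l ∈ Finset.range (k + r + 1), A k l * blockEntry B l n :=
  blockEntry_eq_of_apply fun v => by
    rw [mul_apply_eq_comp, bandOp_apply, map_sum, sum_apply]
    refine Finset.sum_congr rfl fun l _ => ?_
    rw [apply_lp_single, map_mul, mul_apply_eq_comp]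

theorem blockEntry_bandOp (hA : IsBand r s A) (hb : IsBdd A) (k n : ℕ) :
    blockEntry (bandOp A hA hb) k n = A k n := by
  have h := blockEntry_bandOp_mul hA hb 1 k n
  simp only [mul_one, blockEntry_one, mul_ite, mul_zero, Finset.sum_ite_eq',
    Finset.mem_range] at h
  rw [h]
  split_ifs with h'
  · rfl
  · exact (hA.zero_upper k n (by omega)).symm

/-- The column `n` of `A` has finitely many nonzero blocks, so `B` is applied to a finite sum. -/
theorem blockEntry_mul_bandOp (hA : IsBand r s A) (hb : IsBdd A) (B : L2Seq N →L[ℂ] L2Seq N)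
    (k n : ℕ) : blockEntry (B * bandOp A hA hb) k n =
      ∑ l ∈ Finset.range (n + s + 1), blockEntry B k l * A l n :=
  blockEntry_eq_of_apply fun v => by
    have h : bandOp A hA hb (lp.single 2 n v) = (∑ l ∈ Finset.range (n + s + 1),
        lp.single 2 l (Matrix.toEuclideanCLM (𝕜 := ℂ) (A l n) v) : L2Seq N) := by
      refine lp.ext (funext fun k => ?_)
      rw [apply_lp_single, blockEntry_bandOp, lp.coeFn_sum, Finset.sum_apply]
      simp only [lp.single_apply, Pi.single_apply, Finset.sum_ite_eq, Finset.mem_range]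
      split_ifs with h'
      · rfl
      · rw [hA.zero_lower k n (by omega)]; simp
    rw [mul_apply_eq_comp, h, map_sum, map_sum, sum_apply,
      lp.coeFn_sum, Finset.sum_apply]
    refine Finset.sum_congr rfl fun l _ => ?_
    rw [apply_lp_single, map_mul, mul_apply_eq_comp]

end Operators

/-! ### Schur's test for the kernel `q ^ |n - k|`. -/

section Schur

/-- The absolute difference of two indices. -/
def gap (k n : ℕ) : ℕ := ((n : ℤ) - (k : ℤ)).natAbs

theorem gap_comm (k n : ℕ) : gap k n = gap n k := by
  unfold gap; omega

/-- Each side of the diagonal contributes at most a geometric series `(1 - q)⁻¹`. -/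
theorem hasSum_pow_gap {q : ℝ} (h0 : 0 < q) (h1 : q < 1) (k : ℕ) :
    ∃ S ≤ 2 / (1 - q), HasSum (fun n => q ^ gap k n) S := by
  have hg : HasSum (fun n => q ^ gap k (n + k)) (1 - q)⁻¹ := by
    have e (n : ℕ) : gap k (n + k) = n := by unfold gap; omega
    simpa only [e] using hasSum_geometric_of_lt_one h0.le h1
  refine ⟨_, ?_, (hasSum_nat_add_iff k).1 hg⟩
  have hle : ∑ n ∈ Finset.range k, q ^ gap k n ≤ (1 - q)⁻¹ := by
    rw [← Finset.sum_range_reflect]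
    refine le_trans (Finset.sum_le_sum fun n hn => ?_)
      (sum_le_hasSum (Finset.range k) (fun n _ => by positivity)
        (hasSum_geometric_of_lt_one h0.le h1))
    have := Finset.mem_range.1 hn
    exact pow_le_pow_of_le_one h0.le h1.le (by unfold gap; omega)
  rw [div_eq_mul_inv]
  linarith

variable {q : ℝ} {x : ℕ → ℝ}

theorem summable_pow_gap_mul_sq (h0 : 0 < q) (h1 : q < 1) (hx : Summable fun n => x n ^ 2)
    (k : ℕ) : Summable fun n => q ^ gap k n * x n ^ 2 :=
  hx.of_nonneg_of_le (fun n => by positivity) fun n =>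
    mul_le_of_le_one_left (sq_nonneg _) (pow_le_one₀ h0.le h1.le)

theorem summable_pow_gap_mul (h0 : 0 < q) (h1 : q < 1) (hx0 : ∀ n, 0 ≤ x n)
    (hx : Summable fun n => x n ^ 2) (k : ℕ) : Summable fun n => q ^ gap k n * x n := by
  obtain ⟨S, -, hS⟩ := hasSum_pow_gap h0 h1 k
  refine (hS.summable.add (summable_pow_gap_mul_sq h0 h1 hx k)).of_nonneg_of_le
    (fun n => mul_nonneg (by positivity) (hx0 n)) fun n => ?_
  -- Summability comes from the comparison `x ≤ 1 + x²`.
  have : 0 ≤ q ^ gap k n * (1 + x n ^ 2 - x n) :=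
    mul_nonneg (by positivity) (by nlinarith [sq_nonneg (x n - 1), hx0 n])
  linarith

/-- Cauchy–Schwarz, with the weight split as `(q^g x)² = q^g · (q^g x²)`. -/
theorem tsum_pow_gap_mul_sq_le (h0 : 0 < q) (h1 : q < 1) (hx0 : ∀ n, 0 ≤ x n)
    (hx : Summable fun n => x n ^ 2) (k : ℕ) :
    (∑' n, q ^ gap k n * x n) ^ 2 ≤ 2 / (1 - q) * ∑' n, q ^ gap k n * x n ^ 2 := by
  obtain ⟨S, hS1, hS⟩ := hasSum_pow_gap h0 h1 k
  refine le_of_tendsto' ((summable_pow_gap_mul h0 h1 hx0 hx k).hasSum.pow 2) fun t => ?_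
  refine (Finset.sum_sq_le_sum_mul_sum_of_sq_le_mul t (f := fun n => q ^ gap k n)
    (g := fun n => q ^ gap k n * x n ^ 2) (fun n _ => by positivity) (fun n _ => by positivity)
    fun n _ => le_of_eq (by ring)).trans ?_
  refine mul_le_mul ((sum_le_hasSum t (fun n _ => by positivity) hS).trans hS1)
    ((summable_pow_gap_mul_sq h0 h1 hx k).sum_le_tsum t fun n _ => by positivity)
    (Finset.sum_nonneg fun n _ => by positivity) ?_
  exact div_nonneg zero_le_two (by linarith)

/-- Schur's test for the kernel `q ^ |n - k|`. -/
theorem sum_sq_tsum_pow_gap_le (h0 : 0 < q) (h1 : q < 1) (hx0 : ∀ n, 0 ≤ x n)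
    (hx : Summable fun n => x n ^ 2) (t : Finset ℕ) :
    ∑ k ∈ t, (∑' n, q ^ gap k n * x n) ^ 2 ≤ (2 / (1 - q)) ^ 2 * ∑' n, x n ^ 2 := by
  have hK : 0 ≤ 2 / (1 - q) := div_nonneg zero_le_two (by linarith)
  refine (Finset.sum_le_sum fun k _ => tsum_pow_gap_mul_sq_le h0 h1 hx0 hx k).trans ?_
  rw [← Finset.mul_sum, sq, mul_assoc]
  refine mul_le_mul_of_nonneg_left ?_ hK
  -- After exchanging the sums, the symmetry of the kernel bounds the column sums like the row sums.
  rw [← Summable.tsum_finsetSum fun k _ => summable_pow_gap_mul_sq h0 h1 hx k, ← tsum_mul_left]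
  refine (summable_sum fun k _ => summable_pow_gap_mul_sq h0 h1 hx k).tsum_le_tsum (fun n => ?_)
    (hx.mul_left _)
  rw [← Finset.sum_mul]
  refine mul_le_mul_of_nonneg_right ?_ (sq_nonneg _)
  obtain ⟨S, hS1, hS⟩ := hasSum_pow_gap h0 h1 n
  simp only [fun k => gap_comm k n]
  exact (sum_le_hasSum t (fun n _ => by positivity) hS).trans hS1

end Schur

/-! ### Bounded operators from exponentially decaying kernels. -/

section KernelOperator

variable {N : ℕ}

theorem hasSum_norm_sq (u : L2Seq N) : HasSum (fun n => ‖u n‖ ^ 2) (‖u‖ ^ 2) := by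
  simpa using lp.hasSum_norm (p := 2) (by simp) u

/-- A kernel with exponential decay is the matrix of a bounded operator on `l^2_N`. -/
theorem exists_operator_of_decay {K : ℕ → ℕ → Blk N} {C q : ℝ} (hC : 0 ≤ C) (h0 : 0 < q)
    (h1 : q < 1) (hK : ∀ k n, ‖K k n‖ ≤ C * q ^ gap k n) :
    ∃ B : L2Seq N →L[ℂ] L2Seq N, (∀ k n, blockEntry B k n = K k n) ∧
      (∀ u k, B u k = ∑' n, Matrix.toEuclideanCLM (𝕜 := ℂ) (K k n) (u n)) ∧
      ‖B‖ ≤ C * (2 / (1 - q)) := by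
  have hD : 0 ≤ C * (2 / (1 - q)) := mul_nonneg hC (div_nonneg zero_le_two (by linarith))
  have hterm (u : L2Seq N) (k n : ℕ) : ‖Matrix.toEuclideanCLM (𝕜 := ℂ) (K k n) (u n)‖ ≤
      C * (q ^ gap k n * ‖u n‖) := by
    rw [← mul_assoc]
    exact (ContinuousLinearMap.le_opNorm _ _).trans
      (mul_le_mul_of_nonneg_right (hK k n) (norm_nonneg _))
  have hsn (u : L2Seq N) (k : ℕ) : Summable fun n => C * (q ^ gap k n * ‖u n‖) :=
    (summable_pow_gap_mul h0 h1 (fun n => norm_nonneg (u n)) (hasSum_norm_sq u).summable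
      k).mul_left C
  have hsum (u : L2Seq N) (k : ℕ) :
      Summable fun n => Matrix.toEuclideanCLM (𝕜 := ℂ) (K k n) (u n) :=
    .of_norm_bounded (hsn u k) (hterm u k)
  have hbd (u : L2Seq N) (t : Finset ℕ) :
      ∑ k ∈ t, ‖∑' n, Matrix.toEuclideanCLM (𝕜 := ℂ) (K k n) (u n)‖ ^ 2 ≤
        (C * (2 / (1 - q)) * ‖u‖) ^ 2 := by
    have := sum_sq_tsum_pow_gap_le h0 h1 (fun n => norm_nonneg (u n))
      (hasSum_norm_sq u).summable t
    rw [(hasSum_norm_sq u).tsum_eq] at this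
    calc _ ≤ ∑ k ∈ t, (C * ∑' n, q ^ gap k n * ‖u n‖) ^ 2 := by
          refine Finset.sum_le_sum fun k _ => pow_le_pow_left₀ (norm_nonneg _) ?_ 2
          rw [← tsum_mul_left]
          exact tsum_of_norm_bounded (hsn u k).hasSum (hterm u k)
      _ = C ^ 2 * ∑ k ∈ t, (∑' n, q ^ gap k n * ‖u n‖) ^ 2 := by
          simp only [mul_pow, Finset.mul_sum]
      _ ≤ C ^ 2 * ((2 / (1 - q)) ^ 2 * ‖u‖ ^ 2) := mul_le_mul_of_nonneg_left this (sq_nonneg C)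
      _ = _ := by ring
  have hmem (u : L2Seq N) :
      Memℓp (fun k => ∑' n, Matrix.toEuclideanCLM (𝕜 := ℂ) (K k n) (u n)) 2 :=
    memℓp_gen' (C := (C * (2 / (1 - q)) * ‖u‖) ^ 2) fun t => by
      simp only [ENNReal.toReal_ofNat, Real.rpow_ofNat]
      exact hbd u t
  have hnorm (u : L2Seq N) : ‖(⟨fun k => ∑' n, Matrix.toEuclideanCLM (𝕜 := ℂ) (K k n) (u n),
      hmem u⟩ : L2Seq N)‖ ≤ C * (2 / (1 - q)) * ‖u‖ :=
    lp.norm_le_of_forall_sum_le (by simp) (mul_nonneg hD (norm_nonneg _)) fun t => by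
      simp only [ENNReal.toReal_ofNat, Real.rpow_ofNat]
      exact hbd u t
  let F : L2Seq N →ₗ[ℂ] L2Seq N :=
    { toFun := fun u => ⟨fun k => ∑' n, Matrix.toEuclideanCLM (𝕜 := ℂ) (K k n) (u n), hmem u⟩
      map_add' := fun u v => lp.ext (funext fun k => by
        change ∑' n, Matrix.toEuclideanCLM (𝕜 := ℂ) (K k n) ((u + v : L2Seq N) n) =
          ∑' n, Matrix.toEuclideanCLM (𝕜 := ℂ) (K k n) (u n) +
          ∑' n, Matrix.toEuclideanCLM (𝕜 := ℂ) (K k n) (v n)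
        rw [← (hsum u k).tsum_add (hsum v k)]
        simp)
      map_smul' := fun c u => lp.ext (funext fun k => by
        change ∑' n, Matrix.toEuclideanCLM (𝕜 := ℂ) (K k n) ((c • u : L2Seq N) n) =
          c • ∑' n, Matrix.toEuclideanCLM (𝕜 := ℂ) (K k n) (u n)
        rw [← (hsum u k).tsum_const_smul]
        simp) }
  refine ⟨F.mkContinuous (C * (2 / (1 - q))) hnorm, fun k n => ?_,
    fun u k => rfl, LinearMap.mkContinuous_norm_le _ hD _⟩
  · refine blockEntry_eq_of_apply fun v => ?_
    set w : L2Seq N := lp.single 2 n v with hw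
    have hne (m : ℕ) (hm : m ≠ n) : w m = 0 := lp.single_apply_ne _ _ _ hm
    have hself : w n = v := lp.single_apply_self _ _ _
    change ∑' m, Matrix.toEuclideanCLM (𝕜 := ℂ) (K k m) (w m) = _
    refine (tsum_eq_single n fun m hm => ?_).trans ?_
    · rw [hne m hm, map_zero]
    · rw [hself]

end KernelOperator

/-! ### Exponential decay of inverses of band operators (Combes–Thomas). -/

section CombesThomas

variable {N : ℕ}

/-- Multiplication by a bounded sequence of positive weights. -/
theorem exists_weight_operator {w : ℕ → ℝ} {D : ℝ} (hw0 : ∀ k, 0 ≤ w k) (hw : ∀ k, w k ≤ D) :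
    ∃ W : L2Seq N →L[ℂ] L2Seq N, ∀ u k, W u k = (w k : ℂ) • u k := by
  -- Only an inequality, since the norm is `0` when `N = 0`.
  have hone : ‖(1 : Blk N)‖ ≤ 1 := norm_toEuclideanCLM_le zero_le_one fun v => by simp
  obtain ⟨W, -, hW, -⟩ := exists_operator_of_decay (N := N) (q := 1 / 2)
    (K := fun k n => if k = n then (w k : ℂ) • 1 else 0) ((hw0 0).trans (hw 0))
    (by norm_num) (by norm_num) fun k n => by
      have hD := (hw0 0).trans (hw 0)
      split_ifs with h
      · subst h
        rw [norm_smul, Complex.norm_real, Real.norm_of_nonneg (hw0 k)]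
        have : gap k k = 0 := by unfold gap; omega
        rw [this, pow_zero]
        exact mul_le_mul (hw k) hone (norm_nonneg _) hD
      · rw [norm_zero]; positivity
  refine ⟨W, fun u k => ?_⟩
  rw [hW, tsum_eq_single k fun n hn => by rw [if_neg (Ne.symm hn), map_zero, zero_apply],
    if_pos rfl, map_smul, map_one, smul_apply, one_apply_eq_self]

theorem blockEntry_weight_mul {w : ℕ → ℝ} {W : L2Seq N →L[ℂ] L2Seq N}
    (hW : ∀ u k, W u k = (w k : ℂ) • u k) (B : L2Seq N →L[ℂ] L2Seq N) (k n : ℕ) :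
    blockEntry (W * B) k n = (w k : ℂ) • blockEntry B k n :=
  blockEntry_eq_of_apply fun v => by
    rw [mul_apply_eq_comp, hW, apply_lp_single, map_smul, smul_apply]

theorem weight_apply_single {w : ℕ → ℝ} {W : L2Seq N →L[ℂ] L2Seq N}
    (hW : ∀ u k, W u k = (w k : ℂ) • u k) (n : ℕ) (v : EuclideanSpace ℂ (Fin N)) :
    W (lp.single 2 n v) = (w n : ℂ) • lp.single 2 n v := by
  refine lp.ext (funext fun k => ?_)
  rw [hW, lp.coeFn_smul, Pi.smul_apply, lp.single_apply]
  by_cases h : k = n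
  · rw [h]
  · simp [h]

theorem blockEntry_mul_weight {w : ℕ → ℝ} {W : L2Seq N →L[ℂ] L2Seq N}
    (hW : ∀ u k, W u k = (w k : ℂ) • u k) (B : L2Seq N →L[ℂ] L2Seq N) (k n : ℕ) :
    blockEntry (B * W) k n = (w n : ℂ) • blockEntry B k n :=
  blockEntry_eq_of_apply fun v => by
    rw [mul_apply_eq_comp, weight_apply_single hW, map_smul, lp.coeFn_smul, Pi.smul_apply,
      apply_lp_single, map_smul, smul_apply]

theorem abs_pow_div_pow_sub_one_le {ρ η : ℝ} {p a b : ℕ} (hρ : 1 ≤ ρ) (h : ρ ^ p ≤ 1 + η)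
    (hab : a ≤ b + p) (hba : b ≤ a + p) : |ρ ^ a / ρ ^ b - 1| ≤ η := by
  have hpos : 0 < ρ := by linarith
  have key (d : ℕ) (hd : d ≤ p) : ρ ^ d ≤ 1 + η := (pow_le_pow_right₀ hρ hd).trans h
  rcases le_total b a with hle | hle
  · obtain ⟨d, rfl⟩ := Nat.exists_eq_add_of_le hle
    rw [pow_add, mul_div_cancel_left₀ _ (by positivity), abs_of_nonneg
      (sub_nonneg.2 (one_le_pow₀ hρ))]
    linarith [key d (by omega)]
  · obtain ⟨d, rfl⟩ := Nat.exists_eq_add_of_le hle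
    have h1 : 1 ≤ ρ ^ d := one_le_pow₀ hρ
    rw [pow_add, div_mul_cancel_left₀ (by positivity), abs_of_nonpos
      (sub_nonpos.2 (inv_le_one_of_one_le₀ h1))]
    have h2 := key d (by omega)
    have h3 : ρ ^ d * (ρ ^ d)⁻¹ = 1 := mul_inv_cancel₀ (by positivity)
    have h4 : 0 < (ρ ^ d)⁻¹ := by positivity
    nlinarith

theorem exists_one_lt_pow_le (p : ℕ) {η : ℝ} (hη : 0 < η) : ∃ ρ : ℝ, 1 < ρ ∧ ρ ^ p ≤ 1 + η := by
  have h : ∀ᶠ ρ : ℝ in nhds 1, ρ ^ p < 1 + η := by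
    refine (continuous_pow p).continuousAt.eventually_lt continuousAt_const ?_
    simpa using hη
  obtain ⟨ρ, h1, h2⟩ :=
    ((h.filter_mono nhdsWithin_le_nhds).and (self_mem_nhdsWithin (s := Set.Ioi (1 : ℝ)))).exists
  exact ⟨ρ, h2, h1.le⟩

variable {r s : ℕ} {A : ℕ → ℕ → Blk N}

/-- The commutator of a band operator with a slowly varying weight is small relative to the
weight. -/
theorem exists_commutator (hA : IsBand r s A) (hb : IsBdd A) {C η : ℝ}
    (hC : ∀ i j, ‖A i j‖ ≤ C) (hη : 0 ≤ η) {w : ℕ → ℝ} (hw : ∀ k, 0 < w k)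
    (hslow : ∀ k j, gap k j ≤ r + s → |w k / w j - 1| ≤ η) {W : L2Seq N →L[ℂ] L2Seq N}
    (hW : ∀ u k, W u k = (w k : ℂ) • u k) :
    ∃ E : L2Seq N →L[ℂ] L2Seq N, W * bandOp A hA hb - bandOp A hA hb * W = E * W ∧
      ‖E‖ ≤ η * C * 2 ^ (r + s) * 4 := by
  have hC0 : 0 ≤ C := (norm_nonneg _).trans (hC 0 0)
  -- The entries come from `(w_k - w_j) A_{k,j} = (w_k / w_j - 1) A_{k,j} w_j`. The factor `2 ^ (r +
  -- s)` fits the band under the decay rate `1 / 2`, and `4 = 2 / (1 - 1 / 2)` is the Schur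
  -- constant.
  obtain ⟨E, hE, -, hEn⟩ := exists_operator_of_decay (N := N) (q := 1 / 2)
    (C := η * C * 2 ^ (r + s)) (K := fun k j => ((w k / w j - 1 : ℝ) : ℂ) • A k j)
    (by positivity) (by norm_num) (by norm_num) fun k j => by
      by_cases h : gap k j ≤ r + s
      · rw [norm_smul, Complex.norm_real, Real.norm_eq_abs, mul_assoc (η * C)]
        refine (mul_le_mul (hslow k j h) (hC k j) (norm_nonneg _) hη).trans ?_
        refine le_mul_of_one_le_right (by positivity) ?_
        calc (1 : ℝ) = 2 ^ (r + s) * (1 / 2) ^ (r + s) := by rw [← mul_pow]; norm_num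
          _ ≤ _ := by
            gcongr ?_ * ?_
            exact pow_le_pow_of_le_one (by norm_num) (by norm_num) h
      · have h0 : A k j = 0 := by
          unfold gap at h
          by_cases h' : k + r < j
          · exact hA.zero_upper k j h'
          · exact hA.zero_lower k j (by omega)
        rw [h0, smul_zero, norm_zero]
        positivity
  refine ⟨E, ext_blockEntry fun k j => ?_, hEn.trans_eq (by norm_num)⟩
  rw [blockEntry_sub, blockEntry_weight_mul hW, blockEntry_mul_weight hW,
    blockEntry_mul_weight hW, hE, blockEntry_bandOp, smul_smul, ← sub_smul]
  congr 1
  have : (w j : ℂ) ≠ 0 := by exact_mod_cast (hw j).ne'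
  push_cast
  field_simp

/-- Placing the commutator between two copies of `G` gives `W G - G W`. -/
theorem mul_inverse_of_commutator {S : Type*} [Ring S] {L G W E : S} (hLG : L * G = 1)
    (hGL : G * L = 1) (hE : L * W - W * L = E * W) : W * G = G * W + G * E * (W * G) := by
  have h : G * (L * W - W * L) * G = W * G - G * W := by
    rw [mul_sub, sub_mul, ← mul_assoc G L, hGL, one_mul, ← mul_assoc G W, mul_assoc _ L, hLG,
      mul_one]
  rw [hE] at h
  rw [mul_assoc G E, ← mul_assoc E, ← mul_assoc, h]
  abel

/-- Weighted norm estimate for the matrix of an inverse, if the commutator with the weight is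
small. -/
theorem weight_mul_norm_blockEntry_le {L G W E : L2Seq N →L[ℂ] L2Seq N} {w : ℕ → ℝ}
    (hLG : L * G = 1) (hGL : G * L = 1) (hE : L * W - W * L = E * W) (hGE : ‖G * E‖ ≤ 1 / 2)
    (hw : ∀ k, 0 < w k) (hW : ∀ u k, W u k = (w k : ℂ) • u k) (k n : ℕ) :
    w k * ‖blockEntry G k n‖ ≤ 2 * ‖G‖ * w n := by
  have hk := hw k
  have hn := hw n
  -- On an eigenvector of `W` the commutator term is at most half of `‖W G e‖` and can be absorbed,
  -- which accounts for the factor `2` in the conclusion.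
  have key (e : L2Seq N) (hWe : W e = (w n : ℂ) • e) :
      ‖(W * G) e‖ ≤ w n * (‖G‖ * ‖e‖) + 1 / 2 * ‖(W * G) e‖ := by
    have hy : (W * G) e = (w n : ℂ) • G e + (G * E) ((W * G) e) := by
      have := DFunLike.congr_fun (mul_inverse_of_commutator hLG hGL hE) e
      rwa [add_apply, mul_apply_eq_comp G W, hWe, map_smul, mul_apply_eq_comp (G * E)] at this
    have h1 : ‖(w n : ℂ) • G e‖ ≤ w n * (‖G‖ * ‖e‖) := by
      rw [norm_smul, Complex.norm_real, Real.norm_of_nonneg hn.le]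
      exact mul_le_mul_of_nonneg_left (G.le_opNorm e) hn.le
    have h2 : ‖(G * E) ((W * G) e)‖ ≤ 1 / 2 * ‖(W * G) e‖ :=
      ((G * E).le_opNorm _).trans (mul_le_mul_of_nonneg_right hGE (norm_nonneg _))
    exact (congrArg norm hy).trans_le ((norm_add_le _ _).trans (add_le_add h1 h2))
  rw [← le_div_iff₀' hk]
  refine norm_toEuclideanCLM_le (div_nonneg (mul_nonneg (mul_nonneg zero_le_two (norm_nonneg _))
    hn.le) hk.le) fun v => ?_
  have h1 := key _ (weight_apply_single hW n v)
  rw [lp.norm_single (by simp)] at h1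
  have h2 := norm_apply_le ((W * G) (lp.single 2 n v)) k
  rw [apply_lp_single, blockEntry_weight_mul hW, map_smul, smul_apply, norm_smul,
    Complex.norm_real, Real.norm_of_nonneg hk.le] at h2
  rw [div_mul_eq_mul_div, le_div_iff₀' hk]
  linarith

/-- The matrix of the inverse of a band operator decays exponentially off the diagonal. -/
theorem exists_decay_of_inverse (hA : IsBand r s A) (hb : IsBdd A) {lam : ℂ}
    {G : L2Seq N →L[ℂ] L2Seq N} (hLG : (lam • 1 - bandOp A hA hb) * G = 1)
    (hGL : G * (lam • 1 - bandOp A hA hb) = 1) :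
    ∃ C q : ℝ, 0 < C ∧ 0 < q ∧ q < 1 ∧ ∀ k n, ‖blockEntry G k n‖ ≤ C * q ^ gap k n := by
  obtain ⟨C, hC⟩ := id hb
  have hC0 : 0 ≤ C := (norm_nonneg _).trans (hC 0 0)
  -- `η` makes the commutator small against `‖G‖`; the `+ 1` in its denominator covers `‖G‖ = 0` or
  -- `C = 0`.
  obtain ⟨η, hη0, hη⟩ : ∃ η : ℝ, 0 < η ∧ ‖G‖ * (η * C * 2 ^ (r + s) * 4) ≤ 1 / 2 := by
    refine ⟨1 / (2 * (‖G‖ * (C * 2 ^ (r + s) * 4) + 1)), by positivity, ?_⟩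
    have hX : 0 ≤ ‖G‖ * (C * 2 ^ (r + s) * 4) := by positivity
    set X := ‖G‖ * (C * 2 ^ (r + s) * 4) with hXd
    calc _ = 1 / (2 * (X + 1)) * X := by rw [hXd]; ring
      _ ≤ 1 / 2 := by
        rw [div_mul_eq_mul_div, one_mul, div_le_div_iff₀ (by positivity) two_pos]
        linarith
  obtain ⟨ρ, hρ1, hρ⟩ := exists_one_lt_pow_le (r + s) hη0
  have hρ0 : 0 < ρ := by linarith
  refine ⟨2 * ‖G‖ + 1, ρ⁻¹, by positivity, by positivity, inv_lt_one_of_one_lt₀ hρ1,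
    fun k n => ?_⟩
  -- The cap at `gap k n` keeps the weight bounded without changing it at `k` or `n`. The commutator
  -- bound does not depend on the cap, so the final estimate is uniform in `k` and `n`.
  set w : ℕ → ℝ := fun i => ρ ^ min (gap i n) (gap k n) with hwd
  have hwpos (i : ℕ) : 0 < w i := pow_pos hρ0 _
  have hwn : w n = 1 := by
    have : gap n n = 0 := by unfold gap; omega
    simp [hwd, this]
  have hwk : w k = ρ ^ gap k n := by simp [hwd]
  obtain ⟨W, hW⟩ := exists_weight_operator (N := N) (w := w) (D := ρ ^ gap k n)
    (fun i => (hwpos i).le) fun i => pow_le_pow_right₀ hρ1.le (min_le_right _ _)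
  obtain ⟨E, hE, hEn⟩ := exists_commutator hA hb hC hη0.le hwpos
    (fun i j hij => abs_pow_div_pow_sub_one_le hρ1.le hρ (by unfold gap at hij ⊢; omega)
      (by unfold gap at hij ⊢; omega)) hW
  have hcomm : (lam • 1 - bandOp A hA hb) * W - W * (lam • 1 - bandOp A hA hb) = E * W := by
    rw [← hE, sub_mul, mul_sub, smul_mul_assoc, mul_smul_comm, one_mul, mul_one]
    abel
  have hGE : ‖G * E‖ ≤ 1 / 2 := (norm_mul_le _ _).trans
    ((mul_le_mul_of_nonneg_left hEn (norm_nonneg _)).trans hη)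
  have h := weight_mul_norm_blockEntry_le hLG hGL hcomm hGE hwpos hW k n
  rw [hwk, hwn, mul_one] at h
  rw [inv_pow, ← div_eq_mul_inv, le_div_iff₀' (by positivity)]
  linarith

end CombesThomas

/-! ### Decaying kernels and the resolvent. -/

section Resolvent

variable {N r s : ℕ} {A : ℕ → ℕ → Blk N}

theorem resolvent_of_kernelDecays (hr : 1 ≤ r) (hs : 1 ≤ s) (hA : IsBand r s A) (hb : IsBdd A)
    {lam : ℂ} {M : Matrix (Fin r) (Fin s) (Blk N)} (hM : KernelDecays A lam M) :
    lam ∈ resolventSet ℂ (bandOp A hA hb) ∧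
      ∀ k n, blockEntry (resolvent (bandOp A hA hb) lam) k n = kernelR A lam M k n := by
  obtain ⟨C, q, hC, h0, h1, hdec⟩ := hM
  obtain ⟨B, hB, -, -⟩ := exists_operator_of_decay hC.le h0 h1 hdec
  have hLB : (algebraMap ℂ _ lam - bandOp A hA hb) * B = 1 := ext_blockEntry fun k n => by
    rw [Algebra.algebraMap_eq_smul_one, sub_mul, smul_mul_assoc, one_mul, blockEntry_sub,
      blockEntry_smul, blockEntry_bandOp_mul, blockEntry_one]
    simp only [hB, kernelR_row_identity hr hs hA, sub_sub_cancel]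
  have hBL : B * (algebraMap ℂ _ lam - bandOp A hA hb) = 1 := ext_blockEntry fun k n => by
    rw [Algebra.algebraMap_eq_smul_one, mul_sub, mul_smul_comm, mul_one, blockEntry_sub,
      blockEntry_smul, blockEntry_mul_bandOp, blockEntry_one]
    simp only [hB, kernelR_col_identity hr hs hA, sub_sub_cancel]
  refine ⟨⟨⟨_, B, hLB, hBL⟩, rfl⟩, fun k n => ?_⟩
  rw [resolvent, Ring.inverse_unit (⟨_, B, hLB, hBL⟩ : (L2Seq N →L[ℂ] L2Seq N)ˣ)]
  exact hB k n

theorem kernelDecays_weylMatrix (hr : 1 ≤ r) (hs : 1 ≤ s) (hA : IsBand r s A) (hb : IsBdd A)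
    {lam : ℂ} (hlam : lam ∈ resolventSet ℂ (bandOp A hA hb)) :
    KernelDecays A lam (weylMatrix r s (bandOp A hA hb) lam) := by
  have hLG := Ring.mul_inverse_cancel _ hlam
  have hGL := Ring.inverse_mul_cancel _ hlam
  change _ * resolvent (bandOp A hA hb) lam = 1 at hLG
  change resolvent (bandOp A hA hb) lam * _ = 1 at hGL
  rw [Algebra.algebraMap_eq_smul_one] at hLG hGL
  obtain ⟨C, q, hC, h0, h1, hdec⟩ := exists_decay_of_inverse hA hb hLG hGL
  refine ⟨C, q, hC, h0, h1, fun k n => ?_⟩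
  rw [weylMatrix, ← eq_kernelR hr hs hA
    (G := blockEntry (resolvent (bandOp A hA hb) lam)) ?_ ?_ k n]
  · exact hdec k n
  · intro k n
    have := congrArg (blockEntry · k n) hLG
    simp only [sub_mul, smul_mul_assoc, one_mul, blockEntry_sub, blockEntry_smul,
      blockEntry_bandOp_mul, blockEntry_one] at this
    rw [← this, sub_sub_cancel]
  · intro k n
    have := congrArg (blockEntry · k n) hGL
    simp only [mul_sub, mul_smul_comm, mul_one, blockEntry_sub, blockEntry_smul,
      blockEntry_mul_bandOp, blockEntry_one] at this
    rw [← this, sub_sub_cancel]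

/-- Decay identifies the kernel with the resolvent, which does not depend on `M`, while the corner
of the kernel is `M`. -/
theorem KernelDecays.eq_weylMatrix (hr : 1 ≤ r) (hs : 1 ≤ s) (hA : IsBand r s A) (hb : IsBdd A)
    {lam : ℂ} {M : Matrix (Fin r) (Fin s) (Blk N)} (hM : KernelDecays A lam M) :
    M = weylMatrix r s (bandOp A hA hb) lam := by
  ext1 i j
  rw [weylMatrix, Matrix.of_apply, (resolvent_of_kernelDecays hr hs hA hb hM).2, kernelR_corner]

end Resolvent

end BandResolvent

end

theorem theorem1 (N r s : ℕ) (hr : 1 ≤ r) (hs : 1 ≤ s)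
    (A : ℕ → ℕ → BandResolvent.Blk N) (hA : BandResolvent.IsBand r s A)
    (hb : BandResolvent.IsBdd A) (lam : ℂ) :
    (∀ (M : Matrix (Fin r) (Fin s) (BandResolvent.Blk N)) (k n : ℕ), n < k + s →
      BandResolvent.kernelR A lam M k n =
        BandResolvent.Rrow A lam M k ⬝ᵥ BandResolvent.Qplus r s A lam n) ∧
    (lam ∈ resolventSet ℂ (BandResolvent.bandOp A hA hb) ↔
      ∃ M : Matrix (Fin r) (Fin s) (BandResolvent.Blk N), BandResolvent.KernelDecays A lam M) ∧
    (lam ∈ resolventSet ℂ (BandResolvent.bandOp A hA hb) →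
      (∃! M : Matrix (Fin r) (Fin s) (BandResolvent.Blk N),
        BandResolvent.KernelDecays A lam M) ∧
      ∀ M : Matrix (Fin r) (Fin s) (BandResolvent.Blk N), BandResolvent.KernelDecays A lam M →
        (∀ (i : Fin r) (j : Fin s), M i j = BandResolvent.kernelR A lam M i j) ∧
        M = BandResolvent.weylMatrix r s (BandResolvent.bandOp A hA hb) lam) := by
  refine ⟨fun M k n h => BandResolvent.kernelR_eq_Rrow_dotProduct hr hs hA lam M h,
    ⟨fun h => ⟨_, BandResolvent.kernelDecays_weylMatrix hr hs hA hb h⟩,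
      fun ⟨_, hM⟩ => (BandResolvent.resolvent_of_kernelDecays hr hs hA hb hM).1⟩,
    fun h => ⟨⟨_, BandResolvent.kernelDecays_weylMatrix hr hs hA hb h,
      fun _ hM => hM.eq_weylMatrix hr hs hA hb⟩,
      fun M hM => ⟨fun i j => (BandResolvent.kernelR_corner lam M i j).symm,
        hM.eq_weylMatrix hr hs hA hb⟩⟩⟩
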